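/- Let $\theta:\mathbb{N}\to\mathbb{R}\cup\{\infty\}$, where $\mathbb{N}=\{1,2,3,\dots\}$, satisfy $\theta(1)\ge 2$ and $\theta(n)\ge P^+(n)$ for all $n\ge 2$, where $P^+(n)$ denotes the largest prime factor of $n$. Let $\mathcal{B}$ be the set of positive integers containing $n=1$ and all those $n\ge 2$ with prime factorization $n=p_1^{\alpha_1}\cdots p_k^{\alpha_k}$, $p_1<p_2<\dots<p_k$, which satisfy $$p_{j+1}\le \theta\left(p_1^{\alpha_1}\cdots p_j^{\alpha_j}\right)\qquad (0\le j<k),$$ where $p_1^{\alpha_1}\cdots p_j^{\alpha_j}$ is understood to be $1$ when $j=0$. Let $\chi$ be the characteristic function of $\mathcal{B}$, and let $B(x)$ be the number of positive integers $n\le x$ in $\mathcal{B}$. Here $p$ runs over primes. When $\theta(n)=\infty$, the product $\prod_{p\le\theta(n)}(1-1/p)$ runs over all primes and so equals $0$, and $1/\log\theta(n)$ is read as $0$. Then the series $$L=\sum_{n\ge 1}\frac{\chi(n)}{n}\prod_{p\le\theta(n)}\left(1-\frac1p\right)$$ converges, $0\le L\le 1$, and $\mathcal{B}$ has natural density $1-L$,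 that is, $$B(x)=(1-L)x+o(x)\qquad (x\to\infty).$$ More precisely, for every real $x>0$ the series in the following error term converges, and $$B(x)=(1-L)x+O\left(1+x\sum_{n\ge 1}\frac{\chi(n)}{n\log\theta(n)}\exp\left(-\frac{\max(0,\log(x/n))}{3\log\theta(n)}\right)\right),$$ where the implied constant is absolute (it does not depend on $\theta$ or $x$). -/

import Mathlib

open Filter Asymptotics

noncomputable section

namespace SieveB

/-- `P⁺(n)`, the largest prime factor of `n ≥ 2`, with `P⁺(1) = 1`. -/
def largestPrimeFactor (n : ℕ) : ℕ :=
  if n = 1 then 1 else n.primeFactors.sup id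

/-- The normalisation `θ(1) ≥ 2` and `θ(n) ≥ P⁺(n)` for `n ≥ 2`, where `θ` takes values in
`ℝ ∪ {∞}`. The value `θ 0` plays no role anywhere. -/
def Normalised (θ : ℕ → WithTop ℝ) : Prop :=
  ((2 : ℝ) : WithTop ℝ) ≤ θ 1 ∧
    ∀ n : ℕ, 2 ≤ n → ((largestPrimeFactor n : ℝ) : WithTop ℝ) ≤ θ n

/-- The part of `n` composed of primes smaller than `p`. If `n = p₁^α₁ ⋯ p_k^α_k` with
`p₁ < ⋯ < p_k` and `p = p_{j+1}`, this is `p₁^α₁ ⋯ p_j^α_j` (and `1` when `j = 0`). -/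
def partBelow (n p : ℕ) : ℕ :=
  ∏ q ∈ n.primeFactors with q < p, q ^ n.factorization q

/-- The set `𝓑` of positive integers `n = p₁^α₁ ⋯ p_k^α_k`, `p₁ < ⋯ < p_k`, such that
`p_{j+1} ≤ θ(p₁^α₁ ⋯ p_j^α_j)` for `0 ≤ j < k`; it contains `1`. -/
def setB (θ : ℕ → WithTop ℝ) : Set ℕ :=
  {n | 0 < n ∧ ∀ p ∈ n.primeFactors, ((p : ℝ) : WithTop ℝ) ≤ θ (partBelow n p)}

/-- The characteristic function `χ` of `𝓑`. -/
def chi (θ : ℕ → WithTop ℝ) : ℕ → ℝ :=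
  (setB θ).indicator 1

open Classical in
/-- The counting function `B(x)`, the number of positive integers `n ≤ x` in `𝓑`. -/
def countB (θ : ℕ → WithTop ℝ) (x : ℝ) : ℕ :=
  ((Finset.Icc 1 ⌊x⌋₊).filter (fun n => n ∈ setB θ)).card

/-- The product of `1 - 1/p` over all primes `p ≤ y`. For `y = ∞` it is the infinite product
over all primes, whose partial products converge to `0`. -/
def primeProd (y : WithTop ℝ) : ℝ :=
  ∏' p : {p : ℕ // p.Prime ∧ ((p : ℝ) : WithTop ℝ) ≤ y}, (1 - 1 / ((p : ℕ) : ℝ))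

/-- `1 / log y`, with `1 / log ∞ = 0`. -/
def invLog : WithTop ℝ → ℝ
  | ⊤ => 0
  | (y : ℝ) => 1 / Real.log y

/-- The `n`-th term of the series defining `L`. -/
def termL (θ : ℕ → WithTop ℝ) (n : ℕ) : ℝ :=
  chi θ n / n * primeProd (θ n)

/-- `L = ∑ χ(n)/n ∏_{p ≤ θ(n)} (1 - 1/p)`. -/
def L (θ : ℕ → WithTop ℝ) : ℝ :=
  ∑' n : ℕ, termL θ n

/-- `χ(n) / (n log θ(n)) · exp(-max(0, log(x/n)) / (3 log θ(n)))`. -/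
def termE (θ : ℕ → WithTop ℝ) (x : ℝ) (n : ℕ) : ℝ :=
  chi θ n / n * invLog (θ n) *
    Real.exp (-(max 0 (Real.log (x / n)) / 3 * invLog (θ n)))

end SieveB

end

/-!
Every positive integer `m` is uniquely `n * r` with `n ∈ 𝓑` and `r` free of primes `p ≤ θ(n)`: here
`n` collects the prime powers of `m` below the first prime that violates the inequality defining
`𝓑` (`partInB_spec`, `partInB_mul`). If `Φ(u, y)` counts the integers in `[1, u]` without prime
factors `p ≤ y`, this gives `⌊x⌋ = ∑_{n ∈ 𝓑} Φ(x / n, θ(n))`, and removing `r = 1` from each count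
leaves `⌊x⌋ - B(x)` on the left. Replacing `Φ(x / n, θ(n))` by `(x / n) ∏_{p ≤ θ(n)} (1 - 1/p)` turns
the right-hand side into `L x`. What has to be proved is that the replacement costs, for `u > 0`
and `y ≥ 2`,
`Φ(u, y) - 1_{u ≥ 1} - u ∏_{p ≤ y} (1 - 1/p) ≪ (u / log y) exp (-max(0, log u) / (3 log y))`
(`exists_abs_roughAboveCount_sub_one_le`).

This fundamental lemma is proved by induction on the sifting limit (`exists_abs_sieveError_le`).
Put `s = log u / log y`.
* For bounded `y`, Legendre's sieve suffices.
* For bounded `s`, an upper bound `Φ(u, y) ≪ u / log y` suffices (`roughCount_le`). It follows from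
  `log = Λ * 1`, Chebyshev's bound for `ψ`, and the fact that products of an integer `a ≤ y` and a
  rough integer are all distinct, which bounds the sum of the reciprocals of the rough integers.
* For large `y` and `s`, Buchstab's identity expresses the error at `(u, y)` through the errors at
  `(u / p, p)` with `p ≤ y`. Inserting the bound to be proved gives the sum
  `∑_{p ≤ y} exp (-log u / (3 log p)) / (p log p)`, which is smaller than the target by a factor
  `≪ 1 / s + 1 / log y` (`primeExpSum_le`), so the induction closes.

Partial sums of the series for `L` are densities of disjoint sets of integers, so `0 ≤ L ≤ 1`. The
error series is dominated by the series for `L` by Mertens' lower bound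
`∏_{p ≤ y} (1 - 1/p) ≫ 1 / log y` (`exists_le_mertensProd`); it therefore converges, and dominated
convergence shows that it tends to `0` as `x → ∞`, which gives the natural density.
-/

namespace SieveB

/-! ### Rough numbers and Buchstab's identity -/

/-- `r` is `k`-rough if it has no prime factor smaller than `k`. -/
def IsRough (k r : ℕ) : Prop := ∀ p : ℕ, p.Prime → p ∣ r → k ≤ p

open Classical in
/-- The finite set of `k`-rough integers in `[1, N]`. -/
noncomputable def roughUpTo (N k : ℕ) : Finset ℕ := {r ∈ Finset.Icc 1 N | IsRough k r}

/-- The sifting function `Φ(u, k)`: the number of `k`-rough integers in `[1, u]`. -/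
noncomputable def roughCount (u : ℝ) (k : ℕ) : ℕ := (roughUpTo ⌊u⌋₊ k).card

/-- The Mertens product `∏_{p < k} (1 - 1/p)`. -/
noncomputable def mertensProd (k : ℕ) : ℝ := ∏ p ∈ k.primesBelow, (1 - 1 / (p : ℝ))

/-- The error committed when `Φ(u, k)` is replaced by its expected value. -/
noncomputable def sieveError (u : ℝ) (k : ℕ) : ℝ := roughCount u k - u * mertensProd k

theorem mem_roughUpTo {N k r : ℕ} : r ∈ roughUpTo N k ↔ (1 ≤ r ∧ r ≤ N) ∧ IsRough k r := by
  simp [roughUpTo]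

theorem IsRough.of_dvd {k a b : ℕ} (h : IsRough k b) (hab : a ∣ b) : IsRough k a :=
  fun p hp hpa => h p hp (hpa.trans hab)

theorem isRough_one (k : ℕ) : IsRough k 1 :=
  fun _ hp h => absurd (Nat.dvd_one.1 h) hp.one_lt.ne'

theorem mertensProd_factor_pos {p : ℕ} (hp : p.Prime) : 0 < 1 - 1 / (p : ℝ) := by
  have : (1 : ℝ) < p := by exact_mod_cast hp.one_lt
  rw [sub_pos, div_lt_one (by positivity)]
  exact this

theorem mertensProd_pos (k : ℕ) : 0 < mertensProd k :=
  Finset.prod_pos fun _ hp => mertensProd_factor_pos (Nat.prime_of_mem_primesBelow hp)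

theorem mertensProd_succ_of_prime {k : ℕ} (hk : k.Prime) :
    mertensProd (k + 1) = mertensProd k * (1 - 1 / (k : ℝ)) := by
  unfold mertensProd
  rw [Nat.primesBelow_succ, if_pos hk, Finset.prod_insert (by simp [Nat.primesBelow]), mul_comm]

theorem mertensProd_succ_of_not_prime {k : ℕ} (hk : ¬ k.Prime) :
    mertensProd (k + 1) = mertensProd k := by
  unfold mertensProd
  rw [Nat.primesBelow_succ, if_neg hk]

theorem isRough_succ_iff {k r : ℕ} (hr : k.Prime → ¬ k ∣ r) : IsRough (k + 1) r ↔ IsRough k r := by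
  refine ⟨fun h p hp hpr => (Nat.le_succ k).trans (h p hp hpr), fun h p hp hpr => ?_⟩
  rcases (h p hp hpr).eq_or_lt with rfl | hlt
  · exact absurd hpr (hr hp)
  · exact hlt

theorem roughCount_succ_of_not_prime {k : ℕ} (hk : ¬ k.Prime) (u : ℝ) :
    roughCount u (k + 1) = roughCount u k := by
  unfold roughCount
  congr 1
  ext r
  rw [mem_roughUpTo, mem_roughUpTo, isRough_succ_iff fun h => absurd h hk]

/-- Buchstab's identity: the `p`-rough integers which are not `(p+1)`-rough are the products
of `p` and a `p`-rough integer. -/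
theorem roughCount_eq_add {p : ℕ} (hp : p.Prime) (u : ℝ) :
    roughCount u p = roughCount u (p + 1) + roughCount (u / p) p := by
  classical
  unfold roughCount
  rw [← Finset.card_filter_add_card_filter_not (s := roughUpTo ⌊u⌋₊ p) (fun r => ¬ p ∣ r)]
  congr 1
  · congr 1
    ext r
    simp only [Finset.mem_filter, mem_roughUpTo]
    constructor
    · rintro ⟨⟨h1, h2⟩, h3⟩
      exact ⟨h1, (isRough_succ_iff fun _ => h3).2 h2⟩
    · rintro ⟨h1, h2⟩
      have h3 : ¬ p ∣ r := fun h => absurd (h2 p hp h) (by omega)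
      exact ⟨⟨h1, (isRough_succ_iff fun _ => h3).1 h2⟩, h3⟩
  · rw [Nat.floor_div_natCast]
    symm
    refine Finset.card_bij (fun r _ => p * r) ?_ ?_ ?_
    · intro r hr
      obtain ⟨⟨h1, h2⟩, h3⟩ := mem_roughUpTo.1 hr
      simp only [Finset.mem_filter, mem_roughUpTo, not_not]
      refine ⟨⟨⟨Nat.mul_pos hp.pos h1, ?_⟩, ?_⟩, dvd_mul_right _ _⟩
      · rw [mul_comm]; exact (Nat.le_div_iff_mul_le hp.pos).1 h2
      · intro q hq hqr
        rcases (hq.dvd_mul).1 hqr with h | h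
        · exact ((Nat.prime_dvd_prime_iff_eq hq hp).1 h).ge
        · exact h3 q hq h
    · intro a _ b _ h
      exact Nat.eq_of_mul_eq_mul_left hp.pos h
    · intro m hm
      simp only [Finset.mem_filter, mem_roughUpTo, not_not] at hm
      obtain ⟨⟨⟨h1, h2⟩, h3⟩, r, rfl⟩ := hm
      refine ⟨r, mem_roughUpTo.2 ⟨⟨Nat.pos_of_mul_pos_left h1, ?_⟩, h3.of_dvd (dvd_mul_left _ _)⟩,
        rfl⟩
      rw [Nat.le_div_iff_mul_le hp.pos, mul_comm]; exact h2

theorem sieveError_succ_of_not_prime {k : ℕ} (hk : ¬ k.Prime) (u : ℝ) :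
    sieveError u (k + 1) = sieveError u k := by
  rw [sieveError, sieveError, roughCount_succ_of_not_prime hk, mertensProd_succ_of_not_prime hk]

theorem sieveError_succ_of_prime {p : ℕ} (hp : p.Prime) (u : ℝ) :
    sieveError u (p + 1) = sieveError u p - sieveError (u / p) p := by
  rw [sieveError, sieveError, sieveError, mertensProd_succ_of_prime hp, roughCount_eq_add hp u]
  push_cast
  ring

theorem roughUpTo_zero_right (N : ℕ) : roughUpTo N 0 = Finset.Icc 1 N := by
  ext r
  simp [mem_roughUpTo, IsRough]

theorem abs_sieveError_zero_le {u : ℝ} (hu : 0 ≤ u) : |sieveError u 0| ≤ 1 := by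
  have h : sieveError u 0 = ⌊u⌋₊ - u := by
    simp [sieveError, roughCount, mertensProd, roughUpTo_zero_right, Nat.primesBelow]
  rw [h, abs_le]
  constructor <;> linarith [Nat.floor_le hu, Nat.lt_floor_add_one u]

/-- Buchstab's identity iterated down to the trivial sieve. -/
theorem abs_sieveError_le_sum {u : ℝ} (hu : 0 ≤ u) (k : ℕ) :
    |sieveError u k| ≤ 1 + ∑ p ∈ k.primesBelow, |sieveError (u / p) p| := by
  induction k with
  | zero => simpa [Nat.primesBelow] using abs_sieveError_zero_le hu
  | succ k ih =>
    rw [Nat.primesBelow_succ]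
    split_ifs with hk
    · rw [Finset.sum_insert (by simp [Nat.primesBelow]), sieveError_succ_of_prime hk]
      linarith [abs_sub (sieveError u k) (sieveError (u / k) k)]
    · rwa [sieveError_succ_of_not_prime hk]

/-- The error in Legendre's sieve. -/
theorem abs_sieveError_le_two_pow {u : ℝ} (hu : 0 ≤ u) (k : ℕ) : |sieveError u k| ≤ 2 ^ k := by
  induction k generalizing u with
  | zero => simpa using abs_sieveError_zero_le hu
  | succ k ih =>
    by_cases hk : k.Prime
    · rw [sieveError_succ_of_prime hk, pow_succ]
      linarith [abs_sub (sieveError u k) (sieveError (u / k) k), ih hu,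
        ih (show 0 ≤ u / k by positivity)]
    · rw [sieveError_succ_of_not_prime hk, pow_succ]
      linarith [ih hu, show (0 : ℝ) < 2 ^ k by positivity]

/-! ### An upper bound for the sifting function -/

/-- Products of an integer `a < k` and a `k`-rough integer `m` determine `a` and `m`, so these
products contribute at most a harmonic sum. -/
theorem sum_inv_rough_mul_harmonic_le {N k : ℕ} (hk : k ≤ N + 1) :
    (∑ a ∈ Finset.Icc 1 (k - 1), (a : ℝ)⁻¹) * ∑ m ∈ roughUpTo N k, (m : ℝ)⁻¹ ≤
      ∑ n ∈ Finset.Icc 1 (N * N), (n : ℝ)⁻¹ := by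
  have hinj : Set.InjOn (fun x : ℕ × ℕ => x.1 * x.2)
      (Finset.Icc 1 (k - 1) ×ˢ roughUpTo N k : Finset (ℕ × ℕ)) := by
    have hcop : ∀ a m : ℕ, 1 ≤ a → a ≤ k - 1 → IsRough k m → Nat.Coprime a m := by
      intro a m ha1 ha2 hm
      refine Nat.Coprime.symm (Nat.coprime_of_dvd fun p hp hpm hpa => ?_)
      have h1 := hm p hp hpm
      have h2 := Nat.le_of_dvd ha1 hpa
      omega
    rintro ⟨a, m⟩ h1 ⟨b, n⟩ h2 h
    simp only [Finset.coe_product, Set.mem_prod, Finset.mem_coe, Finset.mem_Icc,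
      mem_roughUpTo] at h1 h2 h
    obtain ⟨⟨ha1, ha2⟩, ⟨hm1, -⟩, hm⟩ := h1
    obtain ⟨⟨hb1, hb2⟩, -, hn⟩ := h2
    have hab : a = b := Nat.dvd_antisymm
      ((hcop a n ha1 ha2 hn).dvd_of_dvd_mul_right (h ▸ dvd_mul_right a m))
      ((hcop b m hb1 hb2 hm).dvd_of_dvd_mul_right (h ▸ dvd_mul_right b n))
    subst hab
    simpa using Nat.eq_of_mul_eq_mul_left ha1 h
  rw [Finset.sum_mul_sum, ← Finset.sum_product']
  calc ∑ x ∈ Finset.Icc 1 (k - 1) ×ˢ roughUpTo N k, (x.1 : ℝ)⁻¹ * (x.2 : ℝ)⁻¹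
      = ∑ n ∈ (Finset.Icc 1 (k - 1) ×ˢ roughUpTo N k).image (fun x : ℕ × ℕ => x.1 * x.2),
          (n : ℝ)⁻¹ := by
        rw [Finset.sum_image hinj]
        refine Finset.sum_congr rfl fun x _ => ?_
        push_cast
        rw [mul_inv]
    _ ≤ _ := by
        refine Finset.sum_le_sum_of_subset_of_nonneg ?_ fun _ _ _ => by positivity
        intro n hn
        obtain ⟨⟨a, m⟩, h, rfl⟩ := Finset.mem_image.1 hn
        simp only [Finset.mem_product, Finset.mem_Icc, mem_roughUpTo] at h ⊢
        obtain ⟨⟨ha1, ha2⟩, ⟨hm1, hm2⟩, -⟩ := h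
        exact ⟨Nat.mul_pos ha1 hm1, Nat.mul_le_mul (by omega) hm2⟩

theorem log_mul_sum_inv_rough_le {N k : ℕ} (hk1 : 1 ≤ k) (hk : k ≤ N + 1) (hN : 1 ≤ N) :
    Real.log k * ∑ m ∈ roughUpTo N k, (m : ℝ)⁻¹ ≤ 1 + 2 * Real.log N := by
  have h1 : Real.log k ≤ ∑ a ∈ Finset.Icc 1 (k - 1), (a : ℝ)⁻¹ := by
    have := log_add_one_le_harmonic (k - 1)
    rw [harmonic_eq_sum_Icc] at this
    push_cast [Nat.cast_sub hk1] at this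
    simpa using this
  have h2 : ∑ n ∈ Finset.Icc 1 (N * N), (n : ℝ)⁻¹ ≤ 1 + 2 * Real.log N := by
    have := harmonic_le_one_add_log (N * N)
    rw [harmonic_eq_sum_Icc] at this
    push_cast at this
    rw [Real.log_mul (by positivity) (by positivity)] at this
    linarith
  have h3 : 0 ≤ ∑ m ∈ roughUpTo N k, (m : ℝ)⁻¹ := Finset.sum_nonneg fun _ _ => by positivity
  exact (mul_le_mul_of_nonneg_right h1 h3).trans ((sum_inv_rough_mul_harmonic_le hk).trans h2)

/-- Chebyshev's bound for `ψ`, fed into `log m = ∑_{d ∣ m} Λ(d)`. -/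
theorem sum_log_rough_le {u : ℝ} (hu : 0 ≤ u) (k : ℕ) :
    ∑ m ∈ roughUpTo ⌊u⌋₊ k, Real.log m ≤
      (Real.log 4 + 4) * u * ∑ m ∈ roughUpTo ⌊u⌋₊ k, (m : ℝ)⁻¹ := by
  classical
  set S := roughUpTo ⌊u⌋₊ k with hS
  have h1 : ∀ m ∈ S, Real.log m =
      ∑ d ∈ S, if d ∣ m then ArithmeticFunction.vonMangoldt (m / d) else 0 := by
    intro m hm
    obtain ⟨⟨hm1, hm2⟩, hm3⟩ := mem_roughUpTo.1 hm
    rw [← ArithmeticFunction.vonMangoldt_sum, ← Nat.sum_div_divisors, ← Finset.sum_filter]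
    refine Finset.sum_congr ?_ fun _ _ => rfl
    ext d
    simp only [Nat.mem_divisors, Finset.mem_filter, hS, mem_roughUpTo]
    constructor
    · rintro ⟨h, -⟩
      exact ⟨⟨⟨Nat.pos_of_dvd_of_pos h hm1, (Nat.le_of_dvd hm1 h).trans hm2⟩, hm3.of_dvd h⟩, h⟩
    · rintro ⟨-, h⟩
      exact ⟨h, by omega⟩
  rw [Finset.sum_congr rfl h1, Finset.sum_comm, Finset.mul_sum]
  refine Finset.sum_le_sum fun d hd => ?_
  obtain ⟨⟨hd1, -⟩, -⟩ := mem_roughUpTo.1 hd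
  have h2 : ∑ m ∈ S, (if d ∣ m then ArithmeticFunction.vonMangoldt (m / d) else 0) ≤
      Chebyshev.psi (u / d) := by
    rw [← Finset.sum_filter, Chebyshev.psi, ← Finset.sum_image (g := fun m => m / d)
      (f := fun n => ArithmeticFunction.vonMangoldt n)]
    · refine Finset.sum_le_sum_of_subset_of_nonneg ?_
        fun _ _ _ => ArithmeticFunction.vonMangoldt_nonneg
      intro e he
      obtain ⟨m, hm, rfl⟩ := Finset.mem_image.1 he
      obtain ⟨hmS, hdm⟩ := Finset.mem_filter.1 hm
      obtain ⟨⟨hm1, hm2⟩, -⟩ := mem_roughUpTo.1 hmS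
      rw [Nat.floor_div_natCast, Finset.mem_Ioc]
      exact ⟨Nat.div_pos (Nat.le_of_dvd hm1 hdm) hd1, Nat.div_le_div_right hm2⟩
    · intro a ha b hb hab
      have ha' := (Finset.mem_filter.1 ha).2
      have hb' := (Finset.mem_filter.1 hb).2
      exact (Nat.div_left_inj ha' hb').1 hab
  refine h2.trans ((Chebyshev.psi_le_const_mul_self (by positivity)).trans (le_of_eq ?_))
  rw [div_eq_mul_inv, mul_assoc]

theorem roughCount_mul_log_le {u : ℝ} (hu : 0 < u) (k : ℕ) :
    roughCount u k * Real.log u ≤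
      (Real.log 4 + 5) * u * ∑ m ∈ roughUpTo ⌊u⌋₊ k, (m : ℝ)⁻¹ := by
  have h1 : roughCount u k * Real.log u = ∑ m ∈ roughUpTo ⌊u⌋₊ k, Real.log u := by
    rw [Finset.sum_const, nsmul_eq_mul]; rfl
  have h2 : ∀ m ∈ roughUpTo ⌊u⌋₊ k, Real.log u ≤ Real.log m + u * (m : ℝ)⁻¹ := by
    intro m hm
    obtain ⟨⟨hm1, -⟩, -⟩ := mem_roughUpTo.1 hm
    have hm0 : (0 : ℝ) < m := by exact_mod_cast hm1
    have := Real.log_le_self (x := u / m) (by positivity)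
    rw [Real.log_div hu.ne' hm0.ne', div_eq_mul_inv] at this
    linarith
  rw [h1]
  refine (Finset.sum_le_sum h2).trans ?_
  rw [Finset.sum_add_distrib, ← Finset.mul_sum]
  linarith [sum_log_rough_le hu.le k]

/-- The upper bound sieve `Φ(u, k) ≪ u / log k`. -/
theorem roughCount_le {u : ℝ} {k : ℕ} (hu : 2 ≤ u) (hk : 2 ≤ k) (hku : (k : ℝ) ≤ u + 1) :
    (roughCount u k : ℝ) ≤ 25 * u / Real.log k := by
  have hlk : 0 < Real.log k := Real.log_pos (by exact_mod_cast hk)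
  have hlu : 0 < Real.log u := Real.log_pos (by linarith)
  have hl2 : (0.69 : ℝ) < Real.log u :=
    lt_of_lt_of_le (by linarith [Real.log_two_gt_d9]) (Real.log_le_log (by norm_num) hu)
  have hl4 : Real.log 4 < 1.4 := by
    rw [show (4 : ℝ) = 2 ^ 2 by norm_num, Real.log_pow]
    push_cast
    linarith [Real.log_two_lt_d9]
  have hN : 2 ≤ ⌊u⌋₊ := Nat.le_floor (by exact_mod_cast hu)
  have hkN : k ≤ ⌊u⌋₊ + 1 := by
    have : k - 1 ≤ ⌊u⌋₊ := Nat.le_floor (by rw [Nat.cast_sub (by omega)]; push_cast; linarith)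
    omega
  have h1 := log_mul_sum_inv_rough_le (by omega) hkN (by omega)
  have h2 : Real.log (⌊u⌋₊ : ℝ) ≤ Real.log u :=
    Real.log_le_log (by positivity) (Nat.floor_le (by linarith))
  have h3 := roughCount_mul_log_le (show 0 < u by linarith) k
  set R := ∑ m ∈ roughUpTo ⌊u⌋₊ k, (m : ℝ)⁻¹
  have h4 : roughCount u k * Real.log k * Real.log u ≤ 25 * u * Real.log u := by
    calc roughCount u k * Real.log k * Real.log u
        = (roughCount u k * Real.log u) * Real.log k := by ring
      _ ≤ ((Real.log 4 + 5) * u * R) * Real.log k := mul_le_mul_of_nonneg_right h3 hlk.le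
      _ = (Real.log 4 + 5) * u * (Real.log k * R) := by ring
      _ ≤ (1.4 + 5) * u * (1 + 2 * Real.log u) := by
          have : 0 ≤ Real.log k * R :=
            mul_nonneg hlk.le (Finset.sum_nonneg fun _ _ => by positivity)
          have : 0 ≤ Real.log 4 := Real.log_nonneg (by norm_num)
          gcongr
          linarith
      _ ≤ 25 * u * Real.log u := by nlinarith
  rw [le_div_iff₀ hlk]
  exact le_of_mul_le_mul_right h4 hlu

/-- Mertens' upper bound, read off from the density of the rough integers. -/
theorem mertensProd_le {k : ℕ} (hk : 2 ≤ k) : mertensProd k ≤ 25 / Real.log k := by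
  refine le_of_forall_pos_le_add fun ε hε => ?_
  set u : ℝ := max k (2 ^ k / ε)
  have hku : (k : ℝ) ≤ u := le_max_left _ _
  have hu2 : (2 : ℝ) ≤ u := le_trans (by exact_mod_cast hk) hku
  have h1 := roughCount_le hu2 hk (by linarith)
  have h2 := (abs_le.1 (abs_sieveError_le_two_pow (show 0 ≤ u by linarith) k)).1
  have h3 : (2 : ℝ) ^ k ≤ ε * u := by
    have : 2 ^ k / ε ≤ u := le_max_right _ _
    rw [div_le_iff₀ hε] at this
    linarith
  rw [sieveError] at h2
  have h4 : u * mertensProd k ≤ u * (25 / Real.log k + ε) := by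
    have : u * (25 / Real.log k + ε) = 25 * u / Real.log k + ε * u := by ring
    linarith
  exact le_of_mul_le_mul_left h4 (by linarith)

/-! ### A prime sum -/

/-- The sum over primes that arises when a bound for the sieve error is inserted into
Buchstab's identity. -/
noncomputable def primeExpSum (b y : ℝ) : ℝ :=
  ∑ p ∈ Finset.Ioc 0 ⌊y⌋₊ with p.Prime, Real.exp (-(b / Real.log p)) / (p * Real.log p)

theorem exp_neg_div_log_le {b y z : ℝ} (hb : 0 ≤ b) (hz : 1 < z) (hzy : z ≤ y) :
    Real.exp (-(b / Real.log z)) ≤ Real.exp (-(b / Real.log y)) := by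
  have : 0 < Real.log z := Real.log_pos hz
  gcongr

theorem primeExpSum_le_half_add {b y : ℝ} (hb : 0 ≤ b) (hy : 2 ≤ y) :
    primeExpSum b y ≤ primeExpSum b (y / 2) +
      8 * Real.log 4 * Real.exp (-(b / Real.log y)) / Real.log y ^ 2 := by
  have hly : 0 < Real.log y := Real.log_pos (by linarith)
  have hfl : ⌊y / 2⌋₊ ≤ ⌊y⌋₊ := Nat.floor_mono (by linarith)
  have hsplit : primeExpSum b y = primeExpSum b (y / 2) +
      ∑ p ∈ Finset.Ioc ⌊y / 2⌋₊ ⌊y⌋₊ with p.Prime,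
        Real.exp (-(b / Real.log p)) / (p * Real.log p) := by
    unfold primeExpSum
    simp only [Finset.sum_filter]
    rw [Finset.sum_Ioc_consecutive _ (Nat.zero_le _) hfl]
  rw [hsplit]
  have hterm : ∀ p ∈ (Finset.Ioc ⌊y / 2⌋₊ ⌊y⌋₊).filter Nat.Prime,
      Real.exp (-(b / Real.log p)) / (p * Real.log p) ≤
        8 * Real.exp (-(b / Real.log y)) / (y * Real.log y ^ 2) * Real.log p := by
    intro p hp
    simp only [Finset.mem_filter, Finset.mem_Ioc] at hp
    obtain ⟨⟨h1, h2⟩, h3⟩ := hp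
    have hp2 : (2 : ℝ) ≤ p := by exact_mod_cast h3.two_le
    have hpy : (p : ℝ) ≤ y := (Nat.le_floor_iff (by linarith)).1 h2
    have hyp : y / 2 < p := (Nat.floor_lt (by linarith)).1 h1
    have hlp : 0 < Real.log p := Real.log_pos (by linarith)
    -- `p > y/2` and `p ≥ 2` give `p ^ 2 ≥ y`
    have hlog : Real.log y ≤ 2 * Real.log p := by
      rw [← Real.log_rpow (by linarith)]
      refine Real.log_le_log (by linarith) ?_
      norm_num
      nlinarith
    have hexp := exp_neg_div_log_le hb (show (1 : ℝ) < p by linarith) hpy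
    calc Real.exp (-(b / Real.log p)) / (p * Real.log p)
        ≤ Real.exp (-(b / Real.log y)) / (p * Real.log p) := by gcongr
      _ ≤ _ := by
        rw [div_mul_eq_mul_div, div_le_div_iff₀ (by positivity) (by positivity)]
        have h5 : y * Real.log y ^ 2 ≤ 8 * (p * Real.log p ^ 2) := by
          have : Real.log y ^ 2 ≤ (2 * Real.log p) ^ 2 := by gcongr
          calc y * Real.log y ^ 2 ≤ (2 * p) * (2 * Real.log p) ^ 2 := by
                gcongr
                linarith
            _ = _ := by ring
        have := mul_le_mul_of_nonneg_left h5 (Real.exp_pos (-(b / Real.log y))).le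
        nlinarith
  have htheta : ∑ p ∈ Finset.Ioc ⌊y / 2⌋₊ ⌊y⌋₊ with p.Prime, Real.log p ≤ Real.log 4 * y := by
    refine le_trans ?_ (Chebyshev.theta_le_log4_mul_x (by linarith))
    unfold Chebyshev.theta
    refine Finset.sum_le_sum_of_subset_of_nonneg ?_ fun p hp _ =>
      Real.log_nonneg (by exact_mod_cast (Finset.mem_filter.1 hp).2.one_lt.le)
    exact Finset.filter_subset_filter _ (Finset.Ioc_subset_Ioc_left (Nat.zero_le _))
  have := (Finset.sum_le_sum hterm).trans_eq (Finset.mul_sum _ _ _).symm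
  have h6 := this.trans (mul_le_mul_of_nonneg_left htheta (by positivity))
  have h7 : 8 * Real.exp (-(b / Real.log y)) / (y * Real.log y ^ 2) * (Real.log 4 * y) =
      8 * Real.log 4 * Real.exp (-(b / Real.log y)) / Real.log y ^ 2 := by
    field_simp
  linarith

theorem primeExpSum_of_lt_two {b y : ℝ} (hy : y < 2) : primeExpSum b y = 0 := by
  unfold primeExpSum
  rw [Finset.filter_eq_empty_iff.2, Finset.sum_empty]
  intro p hp hpp
  have h1 := (Finset.mem_Ioc.1 hp).2
  have : ⌊y⌋₊ < 2 := (Nat.floor_lt' two_ne_zero).2 (by exact_mod_cast hy)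
  have := hpp.two_le
  omega

/-- The increments of `exp (-b / log y)` along `y, y/2, y/4, …` dominate the dyadic blocks of
`primeExpSum` below the top one, so these blocks telescope. Dyadic blocks are taken downwards from
`y` itself because the exponent `b / log y` must not be perturbed. -/
theorem primeExpSum_le {b y : ℝ} (hb : 0 < b) (hy : 2 ≤ y) :
    primeExpSum b y ≤ 8 * Real.log 4 * Real.exp (-(b / Real.log y)) *
      (1 / Real.log y ^ 2 + 1 / (b * (Real.log 2 / 2))) := by
  have key : ∀ n : ℕ, ∀ y : ℝ, 2 ≤ y → y < 2 ^ n → primeExpSum b y ≤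
      8 * Real.log 4 * Real.exp (-(b / Real.log y)) *
        (1 / Real.log y ^ 2 + 1 / (b * (Real.log 2 / 2))) := by
    intro n
    induction n with
    | zero => intro y h1 h2; norm_num at h2; linarith
    | succ n ih =>
      intro y h1 h2
      have hl2 : 0 < Real.log 2 := Real.log_pos (by norm_num)
      have hl4 : 0 < Real.log 4 := Real.log_pos (by norm_num)
      have hly : 0 < Real.log y := Real.log_pos (by linarith)
      have h3 := primeExpSum_le_half_add hb.le h1
      rcases lt_or_ge y 4 with h4 | h4
      · rw [primeExpSum_of_lt_two (y := y / 2) (by linarith), zero_add] at h3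
        refine h3.trans ?_
        rw [mul_add, mul_one_div]
        have : 0 ≤ 8 * Real.log 4 * Real.exp (-(b / Real.log y)) *
          (1 / (b * (Real.log 2 / 2))) := by positivity
        linarith
      · have h5 := ih (y / 2) (by linarith) (by rw [pow_succ] at h2; linarith)
        have hlh : Real.log (y / 2) = Real.log y - Real.log 2 :=
          Real.log_div (by linarith) (by norm_num)
        have hly4 : 2 * Real.log 2 ≤ Real.log y := by
          have := Real.log_le_log (by norm_num) h4
          rwa [show (4 : ℝ) = 2 ^ 2 by norm_num, Real.log_pow] at this
        set l := Real.log y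
        set m := Real.log (y / 2)
        have hm : 0 < m := by linarith
        have hlm : l ≤ 2 * m := by linarith
        have hinc : Real.exp (-(b / m)) * (1 / m ^ 2 + 1 / (b * (Real.log 2 / 2))) ≤
            Real.exp (-(b / l)) * (1 / (b * (Real.log 2 / 2))) := by
          have h6 : 1 + b * (Real.log 2 / 2) / m ^ 2 ≤ Real.exp (b / m - b / l) := by
            refine le_trans ?_ (Real.add_one_le_exp _)
            have : b / m - b / l = b * Real.log 2 / (l * m) := by
              field_simp
              linarith
            have h7 : b * (Real.log 2 / 2) / m ^ 2 ≤ b * Real.log 2 / (l * m) := by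
              rw [div_le_div_iff₀ (by positivity) (by positivity)]
              have : 0 < b * Real.log 2 * m := by positivity
              nlinarith
            linarith
          have h8 : Real.exp (-(b / l)) = Real.exp (-(b / m)) * Real.exp (b / m - b / l) := by
            rw [← Real.exp_add]; ring_nf
          rw [h8, mul_assoc]
          refine mul_le_mul_of_nonneg_left ?_ (Real.exp_pos _).le
          refine le_trans (le_of_eq ?_) (mul_le_mul_of_nonneg_right h6 (by positivity))
          field_simp
          ring
        have h9 := mul_le_mul_of_nonneg_left hinc (show 0 ≤ 8 * Real.log 4 by positivity)
        calc primeExpSum b y ≤ _ := h3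
          _ ≤ 8 * Real.log 4 * (Real.exp (-(b / l)) * (1 / (b * (Real.log 2 / 2)))) +
              8 * Real.log 4 * Real.exp (-(b / l)) / l ^ 2 := by
            have := h5.trans_eq (mul_assoc _ _ _)
            linarith
          _ = _ := by ring
  obtain ⟨n, hn⟩ := pow_unbounded_of_one_lt y (by norm_num : (1 : ℝ) < 2)
  exact key n y hy hn

/-! ### The fundamental lemma -/

/-- The bound `u / log y · exp (-log u / (3 log y))` for the sieve error. -/
noncomputable def errorBound (u y : ℝ) : ℝ :=
  u / Real.log y * Real.exp (-(Real.log u / 3 / Real.log y))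

/-- The constant `1/3` in the exponent is admissible for all `y ≥ 2` because `1/3 < log 2`. -/
theorem one_le_errorBound {u y : ℝ} (hy : 2 ≤ y) (hyu : y ≤ u) : 1 ≤ errorBound u y := by
  have hl : 0.69 < Real.log y :=
    lt_of_lt_of_le (by linarith [Real.log_two_gt_d9]) (Real.log_le_log (by norm_num) hy)
  have hlu : Real.log y ≤ Real.log u := Real.log_le_log (by linarith) hyu
  have hl0 : 0 < Real.log y := by linarith
  have hu : u = Real.exp (Real.log u) := (Real.exp_log (by linarith)).symm
  have h1 : Real.log y ≤ u * Real.exp (-(Real.log u / 3 / Real.log y)) := by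
    have h0 : u * Real.exp (-(Real.log u / 3 / Real.log y)) =
        Real.exp (Real.log u + -(Real.log u / 3 / Real.log y)) := by
      rw [Real.exp_add, ← hu]
    rw [h0]
    have h2 : Real.log y - 1 ≤ Real.log u + -(Real.log u / 3 / Real.log y) := by
      have h3 : Real.log u + -(Real.log u / 3 / Real.log y) =
          Real.log u * (1 - 1 / (3 * Real.log y)) := by
        field_simp
        ring
      have h4 : Real.log y - 1 / 3 = Real.log y * (1 - 1 / (3 * Real.log y)) := by
        field_simp
      have h5 : 0 ≤ 1 - 1 / (3 * Real.log y) := by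
        rw [sub_nonneg, div_le_one (by positivity)]
        linarith
      rw [h3]
      nlinarith [mul_le_mul_of_nonneg_right hlu h5]
    calc Real.log y = (Real.log y - 1) + 1 := by ring
      _ ≤ Real.exp (Real.log y - 1) := Real.add_one_le_exp _
      _ ≤ _ := Real.exp_le_exp.2 h2
  rw [errorBound, div_mul_eq_mul_div, one_le_div hl0]
  exact h1

/-- The bound obtained for bounded `log u / log y` from the upper bound sieve. -/
theorem abs_sieveError_le_of_upper {u y : ℝ} {k : ℕ} (hy : 2 ≤ y) (hyk : y ≤ k)
    (hky : (k : ℝ) ≤ y + 1) (hyu : y ≤ u) : |sieveError u k| ≤ 50 * (u / Real.log y) := by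
  have hk : 2 ≤ k := by exact_mod_cast hy.trans hyk
  have hl : 0 < Real.log y := Real.log_pos (by linarith)
  have h1 : 25 * u / Real.log k ≤ 25 * (u / Real.log y) := by
    rw [mul_div_assoc]
    have := Real.log_le_log (by linarith) hyk
    have : 0 ≤ u := by linarith
    gcongr
  have h2 := roughCount_le (hy.trans hyu) hk (by linarith)
  have h3 : u * mertensProd k ≤ 25 * u / Real.log k := by
    have := mul_le_mul_of_nonneg_left (mertensProd_le hk) (show 0 ≤ u by linarith)
    rw [← mul_div_assoc, mul_comm u 25] at this
    exact this
  have h4 : 0 ≤ u * mertensProd k := mul_nonneg (by linarith) (mertensProd_pos k).le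
  have h5 : (0 : ℝ) ≤ roughCount u k := by positivity
  rw [sieveError, abs_le]
  constructor <;> linarith

/-- Inserting the bound `C * errorBound (u / p) p` into Buchstab's identity reproduces at most
half of the bound `C * errorBound u y`, once `y` and `log u / log y` are large. -/
theorem sum_errorBound_le {u y : ℝ} (hy : 1000 ≤ Real.log y)
    (hs : 1000 * Real.log y ≤ Real.log u) (hy2 : 2 ≤ y) (hyu : y ≤ u) {k : ℕ}
    (hky : (k : ℝ) ≤ y + 1) :
    ∑ p ∈ k.primesBelow, errorBound (u / p) p ≤ errorBound u y / 2 := by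
  have hu0 : 0 < u := by linarith
  have hl0 : 0 < Real.log y := by linarith
  have hlu : 0 < Real.log u := by linarith
  have h1 : ∀ p ∈ k.primesBelow, errorBound (u / p) p =
      u * Real.exp (1 / 3) * (Real.exp (-(Real.log u / 3 / Real.log p)) / (p * Real.log p)) := by
    intro p hp
    have hp1 : (1 : ℝ) < p := by exact_mod_cast (Nat.prime_of_mem_primesBelow hp).one_lt
    have hlp : 0 < Real.log p := Real.log_pos hp1
    have : -(Real.log (u / p) / 3 / Real.log p) = 1 / 3 + -(Real.log u / 3 / Real.log p) := by
      rw [Real.log_div hu0.ne' (by linarith)]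
      field_simp
      ring
    rw [errorBound, this, Real.exp_add]
    field_simp
  have h2 : ∑ p ∈ k.primesBelow,
      Real.exp (-(Real.log u / 3 / Real.log p)) / (p * Real.log p) ≤
        primeExpSum (Real.log u / 3) y := by
    unfold primeExpSum
    refine Finset.sum_le_sum_of_subset_of_nonneg ?_ fun p hp _ => ?_
    · intro p hp
      have hpp := Nat.prime_of_mem_primesBelow hp
      have hlt := Nat.lt_of_mem_primesBelow hp
      have : (p : ℝ) + 1 ≤ k := by exact_mod_cast hlt
      simp only [Finset.mem_filter, Finset.mem_Ioc]
      exact ⟨⟨hpp.pos, Nat.le_floor (by linarith)⟩, hpp⟩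
    · have : (1 : ℝ) < p := by exact_mod_cast (Finset.mem_filter.1 hp).2.one_lt
      have := Real.log_pos this
      positivity
  have h3 := primeExpSum_le (b := Real.log u / 3) (by positivity) hy2
  have hl2 := Real.log_two_gt_d9
  have h4 : 8 * Real.log 4 ≤ 11.2 := by
    rw [show (4 : ℝ) = 2 ^ 2 by norm_num, Real.log_pow]
    push_cast
    linarith [Real.log_two_lt_d9]
  have h5 : 1 / Real.log y ^ 2 + 1 / (Real.log u / 3 * (Real.log 2 / 2)) ≤
      (1 / 100) * (1 / Real.log y) := by
    have h6 : 1 / Real.log y ^ 2 ≤ (1 / 1000) * (1 / Real.log y) := by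
      rw [pow_two, ← one_div_mul_one_div]
      refine mul_le_mul_of_nonneg_right ?_ (by positivity)
      exact one_div_le_one_div_of_le (by norm_num) hy
    have h7 : 1 / (Real.log u / 3 * (Real.log 2 / 2)) ≤ (9 / 1000) * (1 / Real.log y) := by
      rw [mul_one_div, div_mul_div_comm, div_le_div_iff₀ (by positivity) (by positivity)]
      have := mul_le_mul hs hl2.le (by norm_num) hlu.le
      linarith
    linarith
  have h8 : Real.exp (1 / 3) ≤ 2.72 :=
    (Real.exp_le_exp.2 (by norm_num : (1 / 3 : ℝ) ≤ 1)).trans (by linarith [Real.exp_one_lt_d9])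
  rw [Finset.sum_congr rfl h1, ← Finset.mul_sum]
  set e := Real.exp (-(Real.log u / 3 / Real.log y)) with he
  have he0 : 0 < e := Real.exp_pos _
  calc _ ≤ u * Real.exp (1 / 3) * (8 * Real.log 4 * e *
        (1 / Real.log y ^ 2 + 1 / (Real.log u / 3 * (Real.log 2 / 2)))) :=
        mul_le_mul_of_nonneg_left (h2.trans h3) (by positivity)
    _ ≤ u * 2.72 * (11.2 * e * ((1 / 100) * (1 / Real.log y))) := by
        have : 0 < Real.log 4 := Real.log_pos (by norm_num)
        have : 0 < Real.log 2 := by linarith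
        gcongr
    _ = 0.30464 * (u / Real.log y * e) := by ring
    _ ≤ errorBound u y / 2 := by
        have : 0 < u / Real.log y * e := by positivity
        rw [errorBound, ← he]
        linarith

/-- The fundamental lemma of the sieve, with error `u exp (-s / 3) / log y`, `s = log u / log y`.
The parameters `y` and `k` with `y ≤ k ≤ y + 1` cover both sifting by the primes `p < y` with `y`
an integer, and sifting by the primes `p ≤ y`; the former occurs in Buchstab's identity. -/
theorem exists_abs_sieveError_le : ∃ C : ℝ, 0 < C ∧ ∀ k : ℕ, ∀ y u : ℝ, 2 ≤ y → y ≤ k →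
    (k : ℝ) ≤ y + 1 → y ≤ u → |sieveError u k| ≤ C * errorBound u y := by
  obtain ⟨K, hK⟩ := exists_nat_ge (Real.exp 1000 + 1)
  obtain ⟨A, hA⟩ : ∃ A : ℝ, A = Real.exp (1000 / 3) := ⟨_, rfl⟩
  have hA0 : 0 < A := hA ▸ Real.exp_pos _
  -- `2 ^ K` serves for bounded `y`, `50 * A` for bounded `log u / log y`, and `2` absorbs the `1`
  -- in Buchstab's identity
  refine ⟨2 + 2 ^ K + 50 * A, by positivity, fun k => ?_⟩
  induction k using Nat.strong_induction_on with
  | _ k ih =>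
  intro y u hy hyk hky hyu
  have hk : 2 ≤ k := by exact_mod_cast hy.trans hyk
  have hl : 0 < Real.log y := Real.log_pos (by linarith)
  have hu0 : 0 < u := by linarith
  have hone := one_le_errorBound hy hyu
  have hC : (0 : ℝ) < 2 ^ K := by positivity
  rcases le_or_gt (Real.log y) 1000 with h1 | h1
  · have h2 : k ≤ K := by
      have : y ≤ Real.exp 1000 := (Real.log_le_iff_le_exp (by linarith)).1 h1
      exact_mod_cast hky.trans ((by linarith : y + 1 ≤ Real.exp 1000 + 1).trans hK)
    calc |sieveError u k| ≤ 2 ^ k := abs_sieveError_le_two_pow hu0.le k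
      _ ≤ 2 ^ K := pow_le_pow_right₀ (by norm_num) h2
      _ = 2 ^ K * 1 := (mul_one _).symm
      _ ≤ _ := mul_le_mul (by linarith) hone zero_le_one (by positivity)
  rcases le_or_gt (Real.log u) (1000 * Real.log y) with h2 | h2
  · have h3 : 1 ≤ A * Real.exp (-(Real.log u / 3 / Real.log y)) := by
      rw [hA, ← Real.exp_add]
      refine Real.one_le_exp ?_
      have : Real.log u / 3 / Real.log y ≤ 1000 / 3 := by
        rw [div_le_iff₀ hl]
        linarith
      linarith
    have h4 : 0 ≤ u / Real.log y := by positivity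
    calc |sieveError u k| ≤ 50 * (u / Real.log y) := abs_sieveError_le_of_upper hy hyk hky hyu
      _ = 50 * (u / Real.log y) * 1 := (mul_one _).symm
      _ ≤ 50 * (u / Real.log y) * (A * Real.exp (-(Real.log u / 3 / Real.log y))) := by gcongr
      _ = 50 * A * errorBound u y := by rw [errorBound]; ring
      _ ≤ _ := mul_le_mul_of_nonneg_right (by linarith) (by linarith)
  · have h3 : ∀ p ∈ k.primesBelow, |sieveError (u / p) p| ≤
        (2 + 2 ^ K + 50 * A) * errorBound (u / p) p := by
      intro p hp
      have hpp := Nat.prime_of_mem_primesBelow hp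
      have hlt := Nat.lt_of_mem_primesBelow hp
      have hp2 : (2 : ℝ) ≤ p := by exact_mod_cast hpp.two_le
      refine ih p hlt p (u / p) hp2 le_rfl (by linarith) ?_
      have hpy : (p : ℝ) ≤ y := by
        have : (p : ℝ) + 1 ≤ k := by exact_mod_cast hlt
        linarith
      -- `p ≤ u / p`, as the induction hypothesis requires, since `p ≤ y` and `y ^ 2 ≤ u`
      rw [le_div_iff₀ (by linarith)]
      have h4 : y * y ≤ u := by
        rw [← Real.log_le_log_iff (by positivity) hu0, Real.log_mul (by linarith) (by linarith)]
        linarith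
      nlinarith
    have h5 := sum_errorBound_le h1.le h2.le hy hyu hky
    have h6 := Finset.sum_le_sum h3
    rw [← Finset.mul_sum] at h6
    have h7 := mul_le_mul_of_nonneg_left h5 (show 0 ≤ 2 + 2 ^ K + 50 * A by positivity)
    have h8 := abs_sieveError_le_sum hu0.le k
    nlinarith

theorem primeCounting_le_roughCount_add (u : ℝ) (k : ℕ) :
    Nat.primeCounting ⌊u⌋₊ ≤ roughCount u k + k := by
  rw [← Nat.primesLE_card_eq_primeCounting, roughCount]
  refine (Finset.card_le_card (t := roughUpTo ⌊u⌋₊ k ∪ Finset.range k) ?_).trans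
    ((Finset.card_union_le _ _).trans (by rw [Finset.card_range]))
  intro p hp
  have hpp := Nat.prime_of_mem_primesLE hp
  have hle := Nat.le_of_mem_primesLE hp
  rw [Finset.mem_union, Finset.mem_range, mem_roughUpTo]
  rcases lt_or_ge p k with h | h
  · exact Or.inr h
  · refine Or.inl ⟨⟨hpp.pos, hle⟩, fun q hq hqp => ?_⟩
    rwa [(Nat.prime_dvd_prime_iff_eq hq hpp).1 hqp]

theorem div_log_le_primeCounting {u : ℝ} (hu : 32 ≤ u) :
    u / (2 * Real.log u) ≤ Nat.primeCounting ⌊u⌋₊ := by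
  have hlu : 0 < Real.log u := Real.log_pos (by linarith)
  refine le_trans ?_ (Chebyshev.pi_ge' (by linarith))
  have h1 : Real.log (u + 2) ≤ (u + 2) / 16 - 1 + 4 * Real.log 2 := by
    have h := Real.log_le_sub_one_of_pos (show 0 < (u + 2) / 16 by linarith)
    rw [Real.log_div (by linarith) (by norm_num), show (16 : ℝ) = 2 ^ 4 by norm_num,
      Real.log_pow] at h
    push_cast at h
    norm_num at h ⊢
    linarith
  have h2 := Real.log_two_gt_d9
  have h3 := Real.log_two_lt_d9
  rw [← div_div]
  gcongr
  nlinarith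

/-- Mertens' lower bound `∏_{p < k} (1 - 1/p) ≫ 1 / log k`. By the fundamental lemma with `u = y ^ N`
and `N` large, a smaller product would leave too few rough integers up to `u` to account for the
primes. -/
theorem exists_le_mertensProd : ∃ c : ℝ, 0 < c ∧ ∀ k : ℕ, ∀ y : ℝ, 2 ≤ y → y ≤ k →
    (k : ℝ) ≤ y + 1 → c / Real.log y ≤ mertensProd k := by
  obtain ⟨C, hC, hmain⟩ := exists_abs_sieveError_le
  have hlim : Tendsto (fun N : ℕ => 8 * (N * (1 / 2 : ℝ) ^ N) +
      C * (N * Real.exp (-(1 / 3)) ^ N)) atTop (nhds (8 * 0 + C * 0)) := by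
    refine (Tendsto.const_mul _ ?_).add (Tendsto.const_mul _ ?_)
    · exact tendsto_self_mul_const_pow_of_lt_one (by norm_num) (by norm_num)
    · exact tendsto_self_mul_const_pow_of_lt_one (Real.exp_pos _).le
        (by simp)
  obtain ⟨N, hN, hN5⟩ := ((hlim.eventually (gt_mem_nhds (show 8 * 0 + C * 0 < (1 / 4 : ℝ) by
    norm_num))).and (eventually_ge_atTop 5)).exists
  have hN0 : (0 : ℝ) < N := by positivity
  refine ⟨1 / (4 * N), by positivity, fun k y hy hyk hky => ?_⟩
  have hl : 0 < Real.log y := Real.log_pos (by linarith)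
  have hly : Real.log y ≤ y := Real.log_le_self (by linarith)
  obtain ⟨u, hu⟩ : ∃ u : ℝ, u = y ^ N := ⟨_, rfl⟩
  have hyu : y ≤ u := hu ▸ le_self_pow₀ (by linarith) (by omega)
  have hu0 : 0 < u := by linarith
  have hu32 : 32 ≤ u := by
    rw [hu]
    calc (32 : ℝ) = 2 ^ 5 := by norm_num
      _ ≤ y ^ 5 := by gcongr
      _ ≤ y ^ N := pow_le_pow_right₀ (by linarith) hN5
  have hlu : Real.log u = N * Real.log y := by rw [hu, Real.log_pow]
  have hprimes : u / (2 * Real.log u) ≤ roughCount u k + k :=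
    (div_log_le_primeCounting hu32).trans (by exact_mod_cast primeCounting_le_roughCount_add u k)
  have herr := (abs_le.1 (hmain k y u hy hyk hky hyu)).2
  have hbound : errorBound u y = u / Real.log y * Real.exp (-(1 / 3)) ^ N := by
    rw [errorBound, hlu, ← Real.exp_nat_mul]
    congr 2
    field_simp
  have hk : (k : ℝ) ≤ u / Real.log y * (8 * (1 / 2) ^ N) := by
    have h1 : (2 : ℝ) ^ N * (1 / 2) ^ N = 1 := by rw [← mul_pow]; norm_num
    have h2 : y ^ 2 * (2 ^ N / 4) ≤ u := by
      obtain ⟨M, rfl⟩ := Nat.exists_eq_add_of_le' (show 2 ≤ N by omega)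
      rw [hu, pow_add, pow_add y]
      have : (2 : ℝ) ^ M ≤ y ^ M := by gcongr
      nlinarith [sq_nonneg y]
    rw [div_mul_eq_mul_div, le_div_iff₀ hl]
    calc k * Real.log y ≤ (2 * y) * y := by
          gcongr
          linarith
      _ = 8 * (y ^ 2 * (2 ^ N / 4)) * (1 / 2) ^ N := by linear_combination (-2 * y ^ 2) * h1
      _ ≤ 8 * u * (1 / 2) ^ N := by gcongr
      _ = u * (8 * (1 / 2) ^ N) := by ring
  rw [sieveError, hbound] at herr
  have hmul : u * (1 / (4 * N) / Real.log y) ≤ u * mertensProd k := by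
    have h1 : u / (2 * Real.log u) = u / Real.log y / N * (1 / 2) := by
      rw [hlu]
      field_simp
    have h2 : u / Real.log y / N * (8 * (N * (1 / 2 : ℝ) ^ N) +
        C * (N * Real.exp (-(1 / 3)) ^ N)) ≤ u / Real.log y / N * (1 / 4) :=
      mul_le_mul_of_nonneg_left hN.le (by positivity)
    have h3 : u / Real.log y / N * (8 * (N * (1 / 2 : ℝ) ^ N) +
        C * (N * Real.exp (-(1 / 3)) ^ N)) = u / Real.log y * (8 * (1 / 2) ^ N) +
          C * (u / Real.log y * Real.exp (-(1 / 3)) ^ N) := by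
      field_simp
    have h4 : u * (1 / (4 * N) / Real.log y) = u / Real.log y / N * (1 / 4) := by
      field_simp
    rw [h4]
    rw [h1] at hprimes
    linarith
  exact le_of_mul_le_mul_left hmul hu0

/-! ### Sifting limits in `ℝ ∪ {∞}` -/

/-- `r` has no prime factor `p ≤ y`. For `y = ∞` this forces `r = 1`. -/
def IsRoughAbove (y : WithTop ℝ) (r : ℕ) : Prop :=
  ∀ p : ℕ, p.Prime → p ∣ r → ¬ ((p : ℝ) : WithTop ℝ) ≤ y

open Classical in
/-- The number of integers in `[1, u]` without prime factors `p ≤ y`. -/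
noncomputable def roughAboveCount (u : ℝ) (y : WithTop ℝ) : ℕ :=
  {r ∈ Finset.Icc 1 ⌊u⌋₊ | IsRoughAbove y r}.card

theorem cast_le_coe_iff {y : ℝ} (hy : 0 ≤ y) (p : ℕ) :
    ((p : ℝ) : WithTop ℝ) ≤ (y : WithTop ℝ) ↔ p < ⌊y⌋₊ + 1 := by
  rw [WithTop.coe_le_coe, Nat.lt_succ_iff, Nat.le_floor_iff hy]

theorem isRoughAbove_coe_iff {y : ℝ} (hy : 0 ≤ y) (r : ℕ) :
    IsRoughAbove (y : WithTop ℝ) r ↔ IsRough (⌊y⌋₊ + 1) r := by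
  simp only [IsRoughAbove, IsRough, cast_le_coe_iff hy, not_lt]

theorem roughAboveCount_coe {y : ℝ} (hy : 0 ≤ y) (u : ℝ) :
    roughAboveCount u (y : WithTop ℝ) = roughCount u (⌊y⌋₊ + 1) := by
  classical
  unfold roughAboveCount roughCount roughUpTo
  congr 1
  exact Finset.filter_congr fun r _ => isRoughAbove_coe_iff hy r

theorem isRoughAbove_one (y : WithTop ℝ) : IsRoughAbove y 1 :=
  fun _ hp h => absurd (Nat.dvd_one.1 h) hp.one_lt.ne'

theorem isRoughAbove_top_iff (r : ℕ) : IsRoughAbove ⊤ r ↔ r = 1 := by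
  refine ⟨fun h => ?_, fun h => h ▸ isRoughAbove_one _⟩
  by_contra hr
  obtain ⟨p, hp, hpr⟩ := Nat.exists_prime_and_dvd hr
  exact h p hp hpr le_top

theorem roughAboveCount_top (u : ℝ) : roughAboveCount u ⊤ = if 1 ≤ u then 1 else 0 := by
  classical
  unfold roughAboveCount
  simp only [isRoughAbove_top_iff, Finset.filter_eq', Finset.mem_Icc, le_refl, true_and,
    Nat.one_le_floor_iff]
  split_ifs <;> simp

theorem primeProd_coe {y : ℝ} (hy : 0 ≤ y) :
    primeProd (y : WithTop ℝ) = mertensProd (⌊y⌋₊ + 1) := by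
  have h : {p : ℕ | p.Prime ∧ ((p : ℝ) : WithTop ℝ) ≤ (y : WithTop ℝ)} =
      ((⌊y⌋₊ + 1).primesBelow : Set ℕ) := by
    ext p
    rw [Set.mem_ofPred_eq, cast_le_coe_iff hy, Finset.mem_coe, Nat.mem_primesBelow, and_comm]
  unfold primeProd mertensProd
  rw [← Finset.tprod_subtype' _ (fun p : ℕ => 1 - 1 / (p : ℝ))]
  exact tprod_congr_set_coe (fun p : ℕ => 1 - 1 / (p : ℝ)) h

theorem primeProd_top : primeProd ⊤ = 0 := by
  classical
  refine HasProd.tprod_eq ?_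
  rw [HasProd, SummationFilter.unconditional_filter]
  have hpos : ∀ p : {p : ℕ // p.Prime ∧ ((p : ℝ) : WithTop ℝ) ≤ ⊤}, 0 < 1 - 1 / ((p : ℕ) : ℝ) :=
    fun p => mertensProd_factor_pos p.2.1
  have hle : ∀ p : {p : ℕ // p.Prime ∧ ((p : ℝ) : WithTop ℝ) ≤ ⊤}, 1 - 1 / ((p : ℕ) : ℝ) ≤ 1 :=
    fun p => sub_le_self _ (by positivity)
  have hlim : Tendsto (fun k : ℕ => 25 / Real.log (k : ℝ)) atTop (nhds 0) :=
    Tendsto.const_div_atTop (Real.tendsto_log_atTop.comp tendsto_natCast_atTop_atTop) _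
  rw [Metric.tendsto_atTop]
  intro ε hε
  obtain ⟨k, hk, hk2⟩ := ((hlim.eventually (gt_mem_nhds hε)).and (eventually_ge_atTop 2)).exists
  refine ⟨k.primesBelow.subtype _, fun s hs => ?_⟩
  have h1 : ∏ p ∈ k.primesBelow.subtype (fun p : ℕ => p.Prime ∧ ((p : ℝ) : WithTop ℝ) ≤ ⊤),
      (1 - 1 / ((p : ℕ) : ℝ)) = mertensProd k := by
    rw [Finset.prod_subtype_eq_prod_filter (fun p : ℕ => 1 - 1 / (p : ℝ)), mertensProd]
    congr 1
    exact Finset.filter_true_of_mem fun p hp => ⟨Nat.prime_of_mem_primesBelow hp, le_top⟩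
  have h2 : ∏ p ∈ s, (1 - 1 / ((p : ℕ) : ℝ)) ≤ mertensProd k := by
    rw [← Finset.prod_sdiff hs, h1]
    refine mul_le_of_le_one_left (mertensProd_pos k).le ?_
    exact Finset.prod_le_one (fun p _ => (hpos p).le) fun p _ => hle p
  have h3 : 0 < ∏ p ∈ s, (1 - 1 / ((p : ℕ) : ℝ)) := Finset.prod_pos fun p _ => hpos p
  rw [Real.dist_eq, sub_zero, abs_of_pos h3]
  exact (h2.trans (mertensProd_le hk2)).trans_lt hk

theorem primeProd_nonneg {y : WithTop ℝ} (hy : ((2 : ℝ) : WithTop ℝ) ≤ y) : 0 ≤ primeProd y := by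
  induction y with
  | top => exact primeProd_top.ge
  | coe y =>
    have hy2 : 2 ≤ y := WithTop.coe_le_coe.1 hy
    rw [primeProd_coe (by linarith)]
    exact (mertensProd_pos _).le

theorem invLog_nonneg {y : WithTop ℝ} (hy : ((2 : ℝ) : WithTop ℝ) ≤ y) : 0 ≤ invLog y := by
  induction y with
  | top => exact le_rfl
  | coe y =>
    have hy2 : 2 ≤ y := WithTop.coe_le_coe.1 hy
    exact one_div_nonneg.2 (Real.log_nonneg (by linarith))

theorem exists_invLog_le_mul_primeProd : ∃ C : ℝ, 0 < C ∧ ∀ y : WithTop ℝ,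
    ((2 : ℝ) : WithTop ℝ) ≤ y → invLog y ≤ C * primeProd y := by
  obtain ⟨c, hc, h⟩ := exists_le_mertensProd
  refine ⟨1 / c, by positivity, fun y hy => ?_⟩
  induction y with
  | top => rw [primeProd_top, mul_zero]; exact le_rfl
  | coe y =>
    have hy2 : 2 ≤ y := WithTop.coe_le_coe.1 hy
    have h1 := h (⌊y⌋₊ + 1) y hy2 (by push_cast; exact (Nat.lt_floor_add_one y).le)
      (by push_cast; linarith [Nat.floor_le (show 0 ≤ y by linarith)])
    rw [primeProd_coe (by linarith)]
    change 1 / Real.log y ≤ _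
    calc 1 / Real.log y = 1 / c * (c / Real.log y) := by field_simp
      _ ≤ _ := by gcongr

/-- For a fixed sifting limit `y`, the error in `Φ(u, y) ≈ u ∏_{p ≤ y} (1 - 1/p)` is bounded. -/
theorem exists_abs_roughAboveCount_sub_le {y : WithTop ℝ} (hy : ((2 : ℝ) : WithTop ℝ) ≤ y) :
    ∃ K : ℝ, ∀ u : ℝ, 0 ≤ u → |roughAboveCount u y - u * primeProd y| ≤ K := by
  induction y with
  | top =>
    refine ⟨1, fun u _ => ?_⟩
    rw [primeProd_top, roughAboveCount_top]
    split_ifs <;> simp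
  | coe y =>
    have hy2 : 2 ≤ y := WithTop.coe_le_coe.1 hy
    refine ⟨2 ^ (⌊y⌋₊ + 1), fun u hu => ?_⟩
    rw [primeProd_coe (by linarith), roughAboveCount_coe (by linarith)]
    exact abs_sieveError_le_two_pow hu _

theorem roughUpTo_of_lt {N k : ℕ} (hN : 1 ≤ N) (hk : N < k) : roughUpTo N k = {1} := by
  ext r
  rw [mem_roughUpTo, Finset.mem_singleton]
  constructor
  · rintro ⟨⟨h1, h2⟩, h3⟩
    by_contra h
    have h4 := h3 r.minFac (Nat.minFac_prime h) (Nat.minFac_dvd r)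
    have h5 := Nat.minFac_le h1
    omega
  · rintro rfl
    exact ⟨⟨le_rfl, hN⟩, isRough_one k⟩

/-- The fundamental lemma for all `u > 0`, with the rough integer `1` removed from the count; the
removal makes the bound hold for `u < y` too. -/
theorem exists_abs_roughAboveCount_sub_one_le : ∃ C : ℝ, 0 < C ∧ ∀ y : WithTop ℝ,
    ((2 : ℝ) : WithTop ℝ) ≤ y → ∀ u : ℝ, 0 < u →
      |(roughAboveCount u y : ℝ) - (if 1 ≤ u then 1 else 0) - u * primeProd y| ≤
        C * (u * invLog y * Real.exp (-(max 0 (Real.log u) / 3 * invLog y))) := by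
  obtain ⟨C, hC, hmain⟩ := exists_abs_sieveError_le
  refine ⟨C + 75, by positivity, fun y hy u hu => ?_⟩
  induction y with
  | top =>
    rw [primeProd_top, roughAboveCount_top]
    simp [invLog]
  | coe y =>
    have hy2 : 2 ≤ y := WithTop.coe_le_coe.1 hy
    have hl : 0 < Real.log y := Real.log_pos (by linarith)
    have hyk : y ≤ (⌊y⌋₊ + 1 : ℕ) := by push_cast; exact (Nat.lt_floor_add_one y).le
    have hky : ((⌊y⌋₊ + 1 : ℕ) : ℝ) ≤ y + 1 := by
      push_cast; linarith [Nat.floor_le (show 0 ≤ y by linarith)]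
    rw [primeProd_coe (by linarith), roughAboveCount_coe (by linarith)]
    change _ ≤ (C + 75) *
      (u * (1 / Real.log y) * Real.exp (-(max 0 (Real.log u) / 3 * (1 / Real.log y))))
    rw [mul_one_div, mul_one_div]
    generalize ⌊y⌋₊ + 1 = k at hyk hky
    have hk2 : 2 ≤ k := by exact_mod_cast hy2.trans hyk
    have hV0 := mertensProd_pos k
    have hV : u * mertensProd k ≤ 25 * (u / Real.log y) := by
      calc u * mertensProd k ≤ u * (25 / Real.log k) := by
            gcongr
            exact mertensProd_le hk2
        _ ≤ u * (25 / Real.log y) := by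
            gcongr
        _ = _ := by ring
    have huV : 0 ≤ u * mertensProd k := by positivity
    rcases lt_or_ge u y with huy | huy
    · -- below the sifting limit only `1` is counted
      have hcount : (roughCount u k : ℝ) - (if 1 ≤ u then 1 else 0) = 0 := by
        have : roughCount u k = if 1 ≤ u then 1 else 0 := by
          have hfloor : ⌊u⌋₊ < k := (Nat.floor_lt hu.le).2 (huy.trans_le hyk)
          rw [roughCount]
          split_ifs with h
          · rw [roughUpTo_of_lt ((Nat.one_le_floor_iff u).2 h) hfloor, Finset.card_singleton]
          · rw [Nat.floor_eq_zero.2 (not_le.1 h)]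
            rfl
        rw [this]
        split_ifs <;> simp
      rw [hcount, zero_sub, abs_neg, abs_of_nonneg huV]
      have hexp : (1 / 3 : ℝ) ≤ Real.exp (-(max 0 (Real.log u) / 3 / Real.log y)) := by
        refine le_trans ?_ (Real.add_one_le_exp _)
        have h1 : max 0 (Real.log u) ≤ Real.log y := max_le hl.le (Real.log_le_log hu huy.le)
        have : max 0 (Real.log u) / 3 / Real.log y ≤ 1 / 3 := by
          rw [div_le_iff₀ hl]
          linarith
        linarith
      calc u * mertensProd k ≤ 25 * (u / Real.log y) := hV
        _ = 75 * (u / Real.log y * (1 / 3)) := by ring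
        _ ≤ (C + 75) * (u / Real.log y *
            Real.exp (-(max 0 (Real.log u) / 3 / Real.log y))) := by
          gcongr
          linarith
    · have hu1 : 1 ≤ u := by linarith
      rw [if_pos hu1, max_eq_right (Real.log_nonneg hu1)]
      change _ ≤ (C + 75) * errorBound u y
      have h1 := abs_le.1 (hmain k y u hy2 hyk hky huy)
      have h2 := one_le_errorBound hy2 huy
      rw [sieveError] at h1
      rw [abs_le]
      constructor <;> linarith [h1.1, h1.2]

/-! ### The factorization of an integer into its part in `𝓑` and a rough cofactor -/

theorem partBelow_mul_of_rough {a b p : ℕ} (ha : a ≠ 0) (hb : b ≠ 0) (hbp : IsRough p b) :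
    partBelow (a * b) p = partBelow a p := by
  unfold partBelow
  have hset : {q ∈ (a * b).primeFactors | q < p} = {q ∈ a.primeFactors | q < p} := by
    ext q
    simp only [Finset.mem_filter, Nat.mem_primeFactors]
    constructor
    · rintro ⟨⟨hq, hqab, -⟩, hqp⟩
      refine ⟨⟨hq, ?_, ha⟩, hqp⟩
      rcases hq.dvd_mul.1 hqab with h | h
      · exact h
      · exact absurd (hbp q hq h) (by omega)
    · rintro ⟨⟨hq, hqa, -⟩, hqp⟩
      exact ⟨⟨hq, hqa.mul_right b, mul_ne_zero ha hb⟩, hqp⟩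
  rw [hset]
  refine Finset.prod_congr rfl fun q hq => ?_
  simp only [Finset.mem_filter, Nat.mem_primeFactors] at hq
  obtain ⟨⟨hq, -, -⟩, hqp⟩ := hq
  have : b.factorization q = 0 :=
    Nat.factorization_eq_zero_of_not_dvd fun h => absurd (hbp q hq h) (by omega)
  rw [Nat.factorization_mul ha hb, Finsupp.add_apply, this, add_zero]

theorem partBelow_eq_self {a p : ℕ} (ha : a ≠ 0) (h : ∀ q, q.Prime → q ∣ a → q < p) :
    partBelow a p = a := by
  unfold partBelow
  rw [Finset.filter_true_of_mem fun q hq =>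
    h q (Nat.prime_of_mem_primeFactors hq) (Nat.dvd_of_mem_primeFactors hq)]
  exact Nat.prod_factorization_pow_eq_self ha

theorem exists_eq_partBelow_mul {m : ℕ} (hm : m ≠ 0) (p : ℕ) :
    ∃ b : ℕ, m = partBelow m p * b ∧ b ≠ 0 ∧ IsRough p b ∧
      ∀ q, q.Prime → q ∣ partBelow m p → q < p := by
  have hprod : m = partBelow m p *
      ∏ q ∈ m.primeFactors with ¬ q < p, q ^ m.factorization q := by
    unfold partBelow
    rw [Finset.prod_filter_mul_prod_filter_not]
    exact (Nat.prod_factorization_pow_eq_self hm).symm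
  have hdvd : ∀ (s : Finset ℕ), s ⊆ m.primeFactors → ∀ q : ℕ, q.Prime →
      q ∣ ∏ r ∈ s, r ^ m.factorization r → q ∈ s := by
    intro s hs q hq h
    obtain ⟨r, hr, hqr⟩ := (hq.prime.dvd_finsetProd_iff _).1 h
    have := (Nat.prime_dvd_prime_iff_eq hq (Nat.prime_of_mem_primeFactors (hs hr))).1
      (hq.dvd_of_dvd_pow hqr)
    rwa [this]
  refine ⟨_, hprod, right_ne_zero_of_mul (hprod ▸ hm), fun q hq h => ?_, fun q hq h => ?_⟩
  · exact not_lt.1 (Finset.mem_filter.1 (hdvd _ (Finset.filter_subset _ _) q hq h)).2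
  · exact (Finset.mem_filter.1 (hdvd _ (Finset.filter_subset _ _) q hq h)).2

open Classical in
/-- The prime factors `p` of `m` which violate the inequality defining `𝓑`. -/
noncomputable def badPrimes (θ : ℕ → WithTop ℝ) (m : ℕ) : Finset ℕ :=
  {p ∈ m.primeFactors | ¬ ((p : ℝ) : WithTop ℝ) ≤ θ (partBelow m p)}

open Classical in
/-- The part of `m` composed of the primes below the first violation of the inequality
defining `𝓑`, and `m` itself if there is none. -/
noncomputable def partInB (θ : ℕ → WithTop ℝ) (m : ℕ) : ℕ :=
  if h : (badPrimes θ m).Nonempty then partBelow m ((badPrimes θ m).min' h) else m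

theorem mem_badPrimes {θ : ℕ → WithTop ℝ} {m p : ℕ} : p ∈ badPrimes θ m ↔
    p ∈ m.primeFactors ∧ ¬ ((p : ℝ) : WithTop ℝ) ≤ θ (partBelow m p) := by
  simp [badPrimes]

theorem partInB_spec (θ : ℕ → WithTop ℝ) {m : ℕ} (hm : m ≠ 0) :
    partInB θ m ∈ setB θ ∧ ∃ r : ℕ, m = partInB θ m * r ∧ r ≠ 0 ∧
      IsRoughAbove (θ (partInB θ m)) r := by
  unfold partInB
  split_ifs with h
  · have hmin := Finset.min'_mem _ h
    have hlt : ∀ q ∈ m.primeFactors, q < (badPrimes θ m).min' h →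
        ((q : ℝ) : WithTop ℝ) ≤ θ (partBelow m q) := by
      intro q hq hqp
      by_contra hcon
      exact absurd (Finset.min'_le _ q (mem_badPrimes.2 ⟨hq, hcon⟩)) (not_le.2 hqp)
    generalize (badPrimes θ m).min' h = p at hmin hlt
    obtain ⟨b, hmb, hb, hbp, hap⟩ := exists_eq_partBelow_mul hm p
    have hp := (mem_badPrimes.1 hmin).2
    have ha : partBelow m p ≠ 0 := left_ne_zero_of_mul (hmb ▸ hm)
    refine ⟨⟨Nat.pos_of_ne_zero ha, fun q hq => ?_⟩, b, hmb, hb, fun q hq hqb hle => ?_⟩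
    · have hqp := hap q (Nat.prime_of_mem_primeFactors hq) (Nat.dvd_of_mem_primeFactors hq)
      have hrough : IsRough q b := fun r hr hrb => hqp.le.trans (hbp r hr hrb)
      rw [← partBelow_mul_of_rough ha hb hrough, ← hmb]
      exact hlt q (Nat.primeFactors_mono ⟨b, hmb⟩ hm hq) hqp
    · refine hp (le_trans ?_ hle)
      exact WithTop.coe_le_coe.2 (by exact_mod_cast hbp q hq hqb)
  · refine ⟨⟨Nat.pos_of_ne_zero hm, fun p hp => ?_⟩, 1, (mul_one m).symm, one_ne_zero,
      isRoughAbove_one _⟩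
    by_contra hcon
    exact h ⟨p, mem_badPrimes.2 ⟨hp, hcon⟩⟩

theorem Normalised.two_le {θ : ℕ → WithTop ℝ} (hθ : Normalised θ) {n : ℕ} (hn : n ≠ 0) :
    ((2 : ℝ) : WithTop ℝ) ≤ θ n := by
  rcases eq_or_ne n 1 with rfl | h1
  · exact hθ.1
  · refine le_trans ?_ (hθ.2 n (by omega))
    rw [largestPrimeFactor, if_neg h1]
    refine WithTop.coe_le_coe.2 ?_
    have h2 : n.minFac ≤ n.primeFactors.sup id := Finset.le_sup (f := id)
      (Nat.mem_primeFactors.2 ⟨Nat.minFac_prime h1, Nat.minFac_dvd n, hn⟩)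
    exact_mod_cast (Nat.minFac_prime h1).two_le.trans h2

theorem Normalised.le_of_dvd {θ : ℕ → WithTop ℝ} (hθ : Normalised θ) {n p : ℕ} (hn : n ≠ 0)
    (hp : p.Prime) (hpn : p ∣ n) : ((p : ℝ) : WithTop ℝ) ≤ θ n := by
  have h1 : n ≠ 1 := fun h => hp.one_lt.ne' (Nat.dvd_one.1 (h ▸ hpn))
  refine le_trans ?_ (hθ.2 n (by omega))
  rw [largestPrimeFactor, if_neg h1]
  refine WithTop.coe_le_coe.2 ?_
  have h2 : p ≤ n.primeFactors.sup id := Finset.le_sup (f := id)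
    (Nat.mem_primeFactors.2 ⟨hp, hpn, hn⟩)
  exact_mod_cast h2

/-- The normalisation `θ(n) ≥ P⁺(n)` enters here: it forces the primes of `r` to be
larger than those of `n`, so that `n` can be recovered from the product `n * r`. -/
theorem partInB_mul {θ : ℕ → WithTop ℝ} (hθ : Normalised θ) {n r : ℕ} (hn : n ∈ setB θ)
    (hr : r ≠ 0) (hrough : IsRoughAbove (θ n) r) : partInB θ (n * r) = n := by
  have hn0 : n ≠ 0 := hn.1.ne'
  have hgood : ∀ q, q ∈ n.primeFactors → IsRough q r → q ∉ badPrimes θ (n * r) := by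
    intro q hq hqr hbad
    apply (mem_badPrimes.1 hbad).2
    rw [partBelow_mul_of_rough hn0 hr hqr]
    exact hn.2 q hq
  -- prime factors of `n` are smaller than those of `r`
  have hlt : ∀ q p : ℕ, q.Prime → q ∣ n → p.Prime → p ∣ r → q < p := by
    intro q p hq hqn hp hpr
    by_contra! hle
    exact hrough p hp hpr (le_trans (WithTop.coe_le_coe.2 (by exact_mod_cast hle))
      (hθ.le_of_dvd hn0 hq hqn))
  have hgood' : ∀ q, q.Prime → q ∣ n → q ∉ badPrimes θ (n * r) := fun q hq hqn =>
    hgood q (Nat.mem_primeFactors.2 ⟨hq, hqn, hn0⟩) fun p hp hpr => (hlt q p hq hqn hp hpr).le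
  unfold partInB
  split_ifs with h
  · have hmem := Finset.min'_mem _ h
    have hle : ∀ q ∈ badPrimes θ (n * r), (badPrimes θ (n * r)).min' h ≤ q :=
      fun q hq => Finset.min'_le _ q hq
    generalize (badPrimes θ (n * r)).min' h = p at hmem hle
    have hp := Nat.mem_primeFactors.1 (mem_badPrimes.1 hmem).1
    have hpr : p ∣ r := (hp.1.dvd_mul.1 hp.2.1).resolve_left fun h' => hgood' p hp.1 h' hmem
    have hr1 : r ≠ 1 := fun h' => hp.1.one_lt.ne' (Nat.dvd_one.1 (h' ▸ hpr))
    have hsmall := Nat.minFac_prime hr1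
    have hbelow : ∀ q, q.Prime → q ∣ r → IsRough q r → partBelow (n * r) q = n := by
      intro q hq hqr hrq
      rw [partBelow_mul_of_rough hn0 hr hrq,
        partBelow_eq_self hn0 fun q' hq' hqn' => hlt q' q hq' hqn' hq hqr]
    have hminrough : IsRough r.minFac r := fun q hq hqr => Nat.minFac_le_of_dvd hq.two_le hqr
    have hminbad : r.minFac ∈ badPrimes θ (n * r) := by
      refine mem_badPrimes.2 ⟨Nat.mem_primeFactors.2
        ⟨hsmall, (Nat.minFac_dvd r).mul_left n, mul_ne_zero hn0 hr⟩, ?_⟩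
      rw [hbelow _ hsmall (Nat.minFac_dvd r) hminrough]
      exact hrough _ hsmall (Nat.minFac_dvd r)
    have hpmin : p = r.minFac :=
      le_antisymm (hle _ hminbad) (Nat.minFac_le_of_dvd hp.1.two_le hpr)
    exact hbelow p hp.1 hpr (hpmin ▸ hminrough)
  · by_contra hne
    have hr1 : r ≠ 1 := fun h' => hne (by rw [h', mul_one])
    have hsmall := Nat.minFac_prime hr1
    refine h ⟨r.minFac, mem_badPrimes.2 ⟨Nat.mem_primeFactors.2
        ⟨hsmall, (Nat.minFac_dvd r).mul_left n, mul_ne_zero hn0 hr⟩, ?_⟩⟩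
    have hminrough : IsRough r.minFac r := fun q hq hqr => Nat.minFac_le_of_dvd hq.two_le hqr
    rw [partBelow_mul_of_rough hn0 hr hminrough,
      partBelow_eq_self hn0 fun q hq hqn => hlt q _ hq hqn hsmall (Nat.minFac_dvd r)]
    exact hrough _ hsmall (Nat.minFac_dvd r)

theorem chi_eq_ite (θ : ℕ → WithTop ℝ) (n : ℕ) [Decidable (n ∈ setB θ)] :
    chi θ n = if n ∈ setB θ then 1 else 0 := by
  simp [chi, Set.indicator_apply]

/-- Every `m ≤ x` is uniquely `n * r` with `n ∈ 𝓑` and `r` free of primes `p ≤ θ(n)`. -/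
theorem sum_chi_mul_roughAboveCount {θ : ℕ → WithTop ℝ} (hθ : Normalised θ) (x : ℝ) :
    ∑ n ∈ Finset.Icc 1 ⌊x⌋₊, chi θ n * roughAboveCount (x / n) (θ n) = ⌊x⌋₊ := by
  classical
  have hmaps : ∀ m ∈ Finset.Icc 1 ⌊x⌋₊,
      partInB θ m ∈ {n ∈ Finset.Icc 1 ⌊x⌋₊ | n ∈ setB θ} := by
    intro m hm
    rw [Finset.mem_Icc] at hm
    obtain ⟨h1, r, h2, -, -⟩ := partInB_spec θ (show m ≠ 0 by omega)
    rw [Finset.mem_filter, Finset.mem_Icc]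
    exact ⟨⟨h1.1, (Nat.le_of_dvd hm.1 ⟨r, h2⟩).trans hm.2⟩, h1⟩
  have hcard := Finset.card_eq_sum_card_fiberwise hmaps
  rw [Nat.card_Icc, Nat.add_sub_cancel] at hcard
  refine Eq.trans ?_ (congrArg (Nat.cast : ℕ → ℝ) hcard).symm
  rw [Nat.cast_sum, Finset.sum_filter]
  refine Finset.sum_congr rfl fun n hn => ?_
  rw [chi_eq_ite]
  split_ifs with hnB
  · rw [one_mul]
    norm_cast
    have hn1 : 1 ≤ n := (Finset.mem_Icc.1 hn).1
    unfold roughAboveCount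
    rw [Nat.floor_div_natCast]
    refine Finset.card_bij (fun r _ => n * r) ?_ ?_ ?_
    · intro r hr
      simp only [Finset.mem_filter, Finset.mem_Icc] at hr ⊢
      obtain ⟨⟨h1, h2⟩, h3⟩ := hr
      refine ⟨⟨Nat.mul_pos hn1 h1, ?_⟩, partInB_mul hθ hnB (by omega) h3⟩
      rw [mul_comm]
      exact (Nat.le_div_iff_mul_le hn1).1 h2
    · intro a _ b _ h
      exact Nat.eq_of_mul_eq_mul_left hn1 h
    · intro m hm
      simp only [Finset.mem_filter, Finset.mem_Icc] at hm
      obtain ⟨⟨h1, h2⟩, h3⟩ := hm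
      obtain ⟨-, r, h4, h5, h6⟩ := partInB_spec θ (show m ≠ 0 by omega)
      rw [h3] at h4 h6
      refine ⟨r, ?_, h4.symm⟩
      simp only [Finset.mem_filter, Finset.mem_Icc]
      refine ⟨⟨Nat.pos_of_ne_zero h5, ?_⟩, h6⟩
      rw [Nat.le_div_iff_mul_le hn1, mul_comm, ← h4]
      exact h2
  · rw [zero_mul]

/-! ### Summation over `𝓑` -/

theorem chi_nonneg (θ : ℕ → WithTop ℝ) (n : ℕ) : 0 ≤ chi θ n :=
  Set.indicator_nonneg (fun _ _ => zero_le_one) n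

theorem chi_zero (θ : ℕ → WithTop ℝ) : chi θ 0 = 0 :=
  Set.indicator_of_notMem (fun h => lt_irrefl 0 h.1) _

theorem termL_nonneg {θ : ℕ → WithTop ℝ} (hθ : Normalised θ) (n : ℕ) : 0 ≤ termL θ n := by
  rcases eq_or_ne n 0 with rfl | hn
  · simp [termL]
  · exact mul_nonneg (div_nonneg (chi_nonneg θ n) (Nat.cast_nonneg n))
      (primeProd_nonneg (hθ.two_le hn))

theorem roughAboveCount_div_eq_zero {x : ℝ} {n : ℕ} (hn : ⌊x⌋₊ < n) (y : WithTop ℝ) :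
    roughAboveCount (x / n) y = 0 := by
  unfold roughAboveCount
  rw [Nat.floor_div_natCast, Nat.div_eq_of_lt hn]
  rfl

theorem sum_chi_mul_roughAboveCount_le {θ : ℕ → WithTop ℝ} (hθ : Normalised θ) {x : ℝ}
    (hx : 0 ≤ x) (s : Finset ℕ) : ∑ n ∈ s, chi θ n * roughAboveCount (x / n) (θ n) ≤ x := by
  classical
  refine le_trans ?_ (Nat.floor_le hx)
  rw [← sum_chi_mul_roughAboveCount hθ x]
  have hnn : ∀ n, 0 ≤ chi θ n * (roughAboveCount (x / n) (θ n) : ℝ) :=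
    fun n => mul_nonneg (chi_nonneg θ n) (Nat.cast_nonneg _)
  refine (Finset.sum_le_sum_of_subset_of_nonneg (Finset.subset_union_left (s₂ :=
    Finset.Icc 1 ⌊x⌋₊)) fun n _ _ => hnn n).trans (le_of_eq ?_)
  symm
  refine Finset.sum_subset Finset.subset_union_right fun n _ hn => ?_
  rcases eq_or_ne n 0 with rfl | hn0
  · rw [chi_zero, zero_mul]
  · rw [Finset.mem_Icc, not_and] at hn
    rw [roughAboveCount_div_eq_zero (not_le.1 (hn (by omega))), Nat.cast_zero, mul_zero]

/-- `termL θ n` is the density of the integers whose part in `𝓑` is `n`; finitely many of these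
disjoint sets have total density at most `1`. -/
theorem sum_termL_le_one {θ : ℕ → WithTop ℝ} (hθ : Normalised θ) (s : Finset ℕ) :
    ∑ n ∈ s, termL θ n ≤ 1 := by
  have hK : ∀ n : ℕ, ∃ K : ℝ, ∀ x : ℝ, 0 ≤ x →
      x * termL θ n ≤ chi θ n * roughAboveCount (x / n) (θ n) + K := by
    intro n
    rcases eq_or_ne n 0 with rfl | hn
    · exact ⟨0, fun x _ => by simp [termL, chi_zero]⟩
    · obtain ⟨K, hK⟩ := exists_abs_roughAboveCount_sub_le (hθ.two_le hn)
      refine ⟨chi θ n * K, fun x hx => ?_⟩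
      have h1 := (abs_le.1 (hK (x / n) (by positivity))).1
      have h2 : x * termL θ n = chi θ n * (x / n * primeProd (θ n)) := by
        rw [termL]
        ring
      rw [h2, ← mul_add]
      exact mul_le_mul_of_nonneg_left (by linarith) (chi_nonneg θ n)
  choose K hK using hK
  refine le_of_forall_pos_le_add fun ε hε => ?_
  set x : ℝ := max 1 ((∑ n ∈ s, K n) / ε)
  have hx : 1 ≤ x := le_max_left _ _
  have h1 : x * ∑ n ∈ s, termL θ n ≤ x + ∑ n ∈ s, K n := by
    rw [Finset.mul_sum]
    refine (Finset.sum_le_sum fun n _ => hK n x (by linarith)).trans ?_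
    rw [Finset.sum_add_distrib]
    linarith [sum_chi_mul_roughAboveCount_le hθ (show 0 ≤ x by linarith) s]
  have h2 : ∑ n ∈ s, K n ≤ ε * x := by
    have : (∑ n ∈ s, K n) / ε ≤ x := le_max_right _ _
    rw [div_le_iff₀ hε] at this
    linarith
  have h3 : x * ∑ n ∈ s, termL θ n ≤ x * (1 + ε) := by linarith
  exact le_of_mul_le_mul_left h3 (by linarith)

theorem summable_termL {θ : ℕ → WithTop ℝ} (hθ : Normalised θ) : Summable (termL θ) :=
  summable_of_sum_le (termL_nonneg hθ) (sum_termL_le_one hθ)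

theorem termE_nonneg {θ : ℕ → WithTop ℝ} (hθ : Normalised θ) (x : ℝ) (n : ℕ) :
    0 ≤ termE θ x n := by
  rcases eq_or_ne n 0 with rfl | hn
  · simp [termE]
  · exact mul_nonneg (mul_nonneg (div_nonneg (chi_nonneg θ n) (Nat.cast_nonneg n))
      (invLog_nonneg (hθ.two_le hn))) (Real.exp_pos _).le

/-- Mertens' lower bound makes the series for `L` dominate the error series. -/
theorem exists_termE_le_mul_termL : ∃ C : ℝ, 0 < C ∧ ∀ θ : ℕ → WithTop ℝ, Normalised θ →
    ∀ (x : ℝ) (n : ℕ), termE θ x n ≤ C * termL θ n := by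
  obtain ⟨C, hC, h⟩ := exists_invLog_le_mul_primeProd
  refine ⟨C, hC, fun θ hθ x n => ?_⟩
  rcases eq_or_ne n 0 with rfl | hn
  · simp [termE, termL]
  have h2 := hθ.two_le hn
  have hc : 0 ≤ chi θ n / n := div_nonneg (chi_nonneg θ n) (Nat.cast_nonneg n)
  have hi := invLog_nonneg h2
  have hexp : Real.exp (-(max 0 (Real.log (x / n)) / 3 * invLog (θ n))) ≤ 1 :=
    Real.exp_le_one_iff.2 (neg_nonpos.2 (by positivity))
  calc termE θ x n ≤ chi θ n / n * invLog (θ n) := mul_le_of_le_one_right (mul_nonneg hc hi) hexp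
    _ ≤ chi θ n / n * (C * primeProd (θ n)) := mul_le_mul_of_nonneg_left (h _ h2) hc
    _ = C * termL θ n := by rw [termL]; ring

theorem summable_termE {θ : ℕ → WithTop ℝ} (hθ : Normalised θ) (x : ℝ) :
    Summable (termE θ x) := by
  obtain ⟨C, -, h⟩ := exists_termE_le_mul_termL
  exact ((summable_termL hθ).mul_left C).of_nonneg_of_le (termE_nonneg hθ x) (h θ hθ x)

theorem tendsto_termE (θ : ℕ → WithTop ℝ) (hθ : Normalised θ) (n : ℕ) :
    Tendsto (fun x => termE θ x n) atTop (nhds 0) := by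
  rcases eq_or_ne n 0 with rfl | hn
  · simp [termE]
  have h2 := hθ.two_le hn
  unfold termE
  generalize θ n = y at h2
  induction y with
  | top => simp [invLog]
  | coe y =>
    have hl : 0 < Real.log y := Real.log_pos (by linarith [WithTop.coe_le_coe.1 h2])
    have hn0 : (0 : ℝ) < n := by positivity
    have hlog : Tendsto (fun x : ℝ => max 0 (Real.log (x / n))) atTop atTop :=
      tendsto_atTop_mono (fun x => le_max_right 0 (Real.log (x / n)))
        (Real.tendsto_log_atTop.comp (tendsto_id.atTop_div_const hn0))
    have hexp := Real.tendsto_exp_neg_atTop_nhds_zero.comp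
      ((hlog.atTop_div_const (show (0 : ℝ) < 3 by norm_num)).atTop_mul_const
        (show 0 < invLog (y : WithTop ℝ) from one_div_pos.2 hl))
    have := hexp.const_mul (chi θ n / n * invLog (y : WithTop ℝ))
    rwa [mul_zero] at this

theorem tendsto_tsum_termE {θ : ℕ → WithTop ℝ} (hθ : Normalised θ) :
    Tendsto (fun x => ∑' n, termE θ x n) atTop (nhds 0) := by
  obtain ⟨C, -, h⟩ := exists_termE_le_mul_termL
  have := tendsto_tsum_of_dominated_convergence ((summable_termL hθ).mul_left C)
    (tendsto_termE θ hθ) (Eventually.of_forall fun x n => by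
      rw [Real.norm_of_nonneg (termE_nonneg hθ x n)]
      exact h θ hθ x n)
  simpa using this

theorem countB_eq_sum (θ : ℕ → WithTop ℝ) (x : ℝ) :
    (countB θ x : ℝ) = ∑ n ∈ Finset.Icc 1 ⌊x⌋₊, chi θ n := by
  classical
  rw [countB, Finset.card_filter, Nat.cast_sum]
  refine Finset.sum_congr rfl fun n _ => ?_
  rw [chi_eq_ite]
  split_ifs <;> simp

theorem hasSum_floor_sub_countB {θ : ℕ → WithTop ℝ} (hθ : Normalised θ) (x : ℝ) :
    HasSum (fun n : ℕ => chi θ n *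
      ((roughAboveCount (x / n) (θ n) : ℝ) - if 1 ≤ x / n then 1 else 0))
      (⌊x⌋₊ - countB θ x) := by
  have hone : ∀ n : ℕ, 1 ≤ n → (1 ≤ x / n ↔ n ≤ ⌊x⌋₊) := by
    intro n hn
    have : (0 : ℝ) < n := by positivity
    rw [one_le_div this, Nat.le_floor_iff' (by omega)]
  have hval : (⌊x⌋₊ : ℝ) - countB θ x = ∑ n ∈ Finset.Icc 1 ⌊x⌋₊, chi θ n *
      ((roughAboveCount (x / n) (θ n) : ℝ) - if 1 ≤ x / n then 1 else 0) := by
    rw [countB_eq_sum, ← sum_chi_mul_roughAboveCount hθ x, ← Finset.sum_sub_distrib]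
    refine Finset.sum_congr rfl fun n hn => ?_
    rw [Finset.mem_Icc] at hn
    rw [if_pos ((hone n hn.1).2 hn.2)]
    ring
  rw [hval]
  refine hasSum_sum_of_ne_finset_zero fun n hn => ?_
  rcases eq_or_ne n 0 with rfl | hn0
  · rw [chi_zero, zero_mul]
  · have h1 : ¬ n ≤ ⌊x⌋₊ := fun h => hn (Finset.mem_Icc.2 ⟨by omega, h⟩)
    rw [roughAboveCount_div_eq_zero (not_le.1 h1), if_neg (mt (hone n (by omega)).1 h1)]
    simp

theorem exists_abs_countB_sub_le : ∃ C : ℝ, 0 < C ∧ ∀ θ : ℕ → WithTop ℝ, Normalised θ →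
    ∀ x : ℝ, 0 < x → |(countB θ x : ℝ) - (1 - L θ) * x| ≤
      C * (1 + x * ∑' n : ℕ, termE θ x n) := by
  obtain ⟨C, hC, h⟩ := exists_abs_roughAboveCount_sub_one_le
  refine ⟨1 + C, by positivity, fun θ hθ x hx => ?_⟩
  have hsum := (hasSum_floor_sub_countB hθ x).sub ((summable_termL hθ).hasSum.mul_left x)
  have hE := (summable_termE hθ x).hasSum.mul_left (C * x)
  have hterm : ∀ n : ℕ, ‖chi θ n *
      ((roughAboveCount (x / n) (θ n) : ℝ) - if 1 ≤ x / n then 1 else 0) - x * termL θ n‖ ≤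
        C * x * termE θ x n := by
    intro n
    rcases eq_or_ne n 0 with rfl | hn
    · simp [termL, termE, chi_zero]
    have hn0 : (0 : ℝ) < n := by positivity
    have h1 := h (θ n) (hθ.two_le hn) (x / n) (by positivity)
    have h2 := mul_le_mul_of_nonneg_left h1 (chi_nonneg θ n)
    rw [← abs_of_nonneg (chi_nonneg θ n), ← abs_mul, abs_of_nonneg (chi_nonneg θ n)] at h2
    rw [Real.norm_eq_abs]
    have e1 : C * x * termE θ x n = chi θ n * (C * (x / n * invLog (θ n) *
        Real.exp (-(max 0 (Real.log (x / n)) / 3 * invLog (θ n))))) := by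
      rw [termE]
      ring
    have e2 : x * termL θ n = chi θ n * (x / n * primeProd (θ n)) := by
      rw [termL]
      ring
    rw [e1, e2, ← mul_sub]
    exact h2
  have hle := tsum_of_norm_bounded hE hterm
  rw [hsum.tsum_eq, Real.norm_eq_abs] at hle
  change |(⌊x⌋₊ : ℝ) - countB θ x - x * L θ| ≤ _ at hle
  have hS : 0 ≤ x * ∑' n, termE θ x n := mul_nonneg hx.le (tsum_nonneg (termE_nonneg hθ x))
  have hCS : 0 ≤ C * (x * ∑' n, termE θ x n) := by positivity
  have h1 := Nat.floor_le hx.le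
  have h2 := Nat.lt_floor_add_one x
  rw [abs_le] at hle ⊢
  constructor <;> nlinarith [hle.1, hle.2]

theorem isLittleO_countB_sub {θ : ℕ → WithTop ℝ} (hθ : Normalised θ) :
    (fun x : ℝ => (countB θ x : ℝ) - (1 - L θ) * x) =o[atTop] (fun x : ℝ => x) := by
  obtain ⟨C, -, h⟩ := exists_abs_countB_sub_le
  have hO : (fun x : ℝ => (countB θ x : ℝ) - (1 - L θ) * x) =O[atTop]
      (fun x : ℝ => 1 + x * ∑' n : ℕ, termE θ x n) := by
    refine IsBigO.of_bound C ?_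
    filter_upwards [eventually_gt_atTop 0] with x hx
    rw [Real.norm_eq_abs, Real.norm_of_nonneg]
    · exact h θ hθ x hx
    · have : 0 ≤ ∑' n, termE θ x n := tsum_nonneg (termE_nonneg hθ x)
      positivity
  refine hO.trans_isLittleO (IsLittleO.add (isLittleO_const_id_atTop 1) ?_)
  have := (isBigO_refl (fun x : ℝ => x) atTop).mul_isLittleO
    ((isLittleO_one_iff ℝ).2 (tendsto_tsum_termE hθ))
  simpa using this

end SieveB

theorem mainTheorem1 :
    (∀ θ : ℕ → WithTop ℝ, SieveB.Normalised θ →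
      Summable (SieveB.termL θ) ∧ 0 ≤ SieveB.L θ ∧ SieveB.L θ ≤ 1 ∧
      (fun x : ℝ => (SieveB.countB θ x : ℝ) - (1 - SieveB.L θ) * x) =o[atTop] (fun x : ℝ => x) ∧
      ∀ x : ℝ, 0 < x → Summable (SieveB.termE θ x)) ∧
    ∃ C : ℝ, 0 < C ∧ ∀ θ : ℕ → WithTop ℝ, SieveB.Normalised θ → ∀ x : ℝ, 0 < x →
      |(SieveB.countB θ x : ℝ) - (1 - SieveB.L θ) * x| ≤
        C * (1 + x * ∑' n : ℕ, SieveB.termE θ x n) :=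
  ⟨fun _ hθ => ⟨SieveB.summable_termL hθ, tsum_nonneg (SieveB.termL_nonneg hθ),
    (SieveB.summable_termL hθ).tsum_le_of_sum_le (SieveB.sum_termL_le_one hθ),
    SieveB.isLittleO_countB_sub hθ, fun x _ => SieveB.summable_termE hθ x⟩,
    SieveB.exists_abs_countB_sub_le⟩
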